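/- Let $d\ge 1$ be an integer. For a non-empty finite set $A\subseteq\mathbb{R}^d$ write $\delta_A=\frac{1}{\#A}\sum_{a\in A}\delta_a$. A Borel probability measure $\mu$ on $\mathbb{R}^d$ is called spectral if there is a countable set $\Lambda\subseteq\mathbb{R}^d$ (a spectrum of $\mu$) such that the functions $e^{-2\pi i\langle\lambda,\cdot\rangle}$, $\lambda\in\Lambda$, form an orthonormal basis of $L^2(\mu)$. For a real $d\times d$ matrix $R$ and finite sets $B,C\subseteq\mathbb{R}^d$, write $B\equiv C \pmod{R\mathbb{Z}^d}$ if $B=\{u+Rz_u : u\in C\}$ for some choice of $z_u\in\mathbb{Z}^d$ $(u\in C)$. Let $(m_k)_{k\ge1}$ be integers with $m_k\ge2$, let $(R_k)_{k\ge1}$ be invertible real $d\times d$ matrices, and let $(B_k)_{k\ge1}$ be finite subsets of $\mathbb{R}^d$ such that $$B_k\equiv\{0,1,\dots,m_k-1\}^d \pmod{R_k\mathbb{Z}^d}\ \text{ for all } k\ge1,\qquad \sum_{k=1}^\infty \frac{\#\big(B_k\setminus\{0,1,\dots,m_k-1\}^d\big)}{m_k^d}<\infty .$$ Suppose that for every $k\ge1$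 all entries of $R_k$ are integer multiples of $m_k$ and $[-m_k,m_k]^d\subseteq R_k^T[-1,1]^d$. Then the infinite convolution $$\mu=\delta_{R_1^{-1}B_1}*\delta_{R_1^{-1}R_2^{-1}B_2}*\delta_{R_1^{-1}R_2^{-1}R_3^{-1}B_3}*\cdots$$ exists, i.e. the finite convolutions of its first $n$ factors converge weakly, as $n\to\infty$, to a Borel probability measure $\mu$, and $\mu$ is a spectral measure with a spectrum contained in $\mathbb{Z}^d$. The measure $\mu$ need not have compact support: for every $d\ge1$ there are sequences $(m_k)$, $(R_k)$, $(B_k)$ satisfying all of the above conditions for which the support of $\mu$ is not compact. -/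

import Mathlib

open MeasureTheory Filter Topology
open scoped Matrix BoundedContinuousFunction

noncomputable section

/-- The uniform discrete measure `δ_A = (1 / #A) ∑_{a ∈ A} δ_a` on a finite set `A ⊆ ℝ^d`. -/
def uniformDirac {d : ℕ} (A : Finset (Fin d → ℝ)) : Measure (Fin d → ℝ) :=
  (A.card : ENNReal)⁻¹ • ∑ a ∈ A, Measure.dirac a

/-- The matrix `R_0⁻¹ R_1⁻¹ ⋯ R_k⁻¹` (sequences are indexed from `0`). -/
def invProd {d : ℕ} (R : ℕ → Matrix (Fin d) (Fin d) ℝ) (k : ℕ) : Matrix (Fin d) (Fin d) ℝ :=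
  ((List.range (k + 1)).map fun j => (R j)⁻¹).prod

/-- The finite set `R_0⁻¹ R_1⁻¹ ⋯ R_k⁻¹ B_k`. -/
def scaledDigits {d : ℕ} (R : ℕ → Matrix (Fin d) (Fin d) ℝ) (B : ℕ → Finset (Fin d → ℝ))
    (k : ℕ) : Finset (Fin d → ℝ) :=
  (B k).image fun b => invProd R k *ᵥ b

/-- The convolution of the first `n` of the measures `δ_{R_0⁻¹ ⋯ R_k⁻¹ B_k}`; the empty
convolution is the Dirac measure at the origin. -/
def finiteConvolution {d : ℕ} (R : ℕ → Matrix (Fin d) (Fin d) ℝ)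
    (B : ℕ → Finset (Fin d → ℝ)) : ℕ → Measure (Fin d → ℝ)
  | 0 => Measure.dirac 0
  | n + 1 => (finiteConvolution R B n).conv (uniformDirac (scaledDigits R B n))

/-- The infinite convolution `δ_{R_0⁻¹ B_0} * δ_{R_0⁻¹ R_1⁻¹ B_1} * ⋯` exists and equals the Borel
probability measure `μ`: the finite convolutions converge weakly to `μ`. -/
def IsInfiniteConvolution {d : ℕ} (R : ℕ → Matrix (Fin d) (Fin d) ℝ)
    (B : ℕ → Finset (Fin d → ℝ)) (μ : ProbabilityMeasure (Fin d → ℝ)) : Prop :=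
  ∀ f : (Fin d → ℝ) →ᵇ ℝ,
    Tendsto (fun n => ∫ x, f x ∂(finiteConvolution R B n)) atTop
      (𝓝 (∫ x, f x ∂(μ : Measure (Fin d → ℝ))))

/-- `ℤ^d` as a subset of `ℝ^d`. -/
def integerLattice (d : ℕ) : Set (Fin d → ℝ) :=
  Set.range fun (z : Fin d → ℤ) (i : Fin d) => (z i : ℝ)

/-- The exponential function `x ↦ e^{-2πi⟨l, x⟩}`. -/
def expFun {d : ℕ} (l x : Fin d → ℝ) : ℂ :=
  Complex.exp (-2 * Real.pi * Complex.I * ((l ⬝ᵥ x : ℝ) : ℂ))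

/-- `S` is a spectrum of `μ`: it is countable, and the exponentials with frequencies in `S`
form an orthonormal (Hilbert) basis of the complex space `L²(μ)`. -/
def IsSpectrum {d : ℕ} (μ : ProbabilityMeasure (Fin d → ℝ)) (S : Set (Fin d → ℝ)) : Prop :=
  S.Countable ∧
    ∃ b : HilbertBasis S ℂ (Lp ℂ 2 (μ : Measure (Fin d → ℝ))),
      ∀ l : S, (b l : (Fin d → ℝ) → ℂ) =ᵐ[(μ : Measure (Fin d → ℝ))] expFun l.1

/-- The set `{0, 1, …, m - 1}^d` in `ℝ^d`. -/
def powerLattice (d m : ℕ) : Finset (Fin d → ℝ) :=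
  Finset.univ.image fun (u : Fin d → Fin m) (i : Fin d) => ((u i : ℕ) : ℝ)

/-- `B ≡ C (mod R ℤ^d)`: `B` arises from `C` by replacing every `u ∈ C` with one point
`u + R z_u`, where `z_u ∈ ℤ^d`. -/
def CongruentMod {d : ℕ} (R : Matrix (Fin d) (Fin d) ℝ) (B C : Finset (Fin d → ℝ)) : Prop :=
  ∃ z : (Fin d → ℝ) → (Fin d → ℤ), B = C.image fun u => u + R *ᵥ fun i => (z u i : ℝ)

/-- `B` is a sequence of nearly `d`-th power lattices with respect to `m` and `R`. -/
def NearlyPowerLattices {d : ℕ} (m : ℕ → ℕ) (R : ℕ → Matrix (Fin d) (Fin d) ℝ)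
    (B : ℕ → Finset (Fin d → ℝ)) : Prop :=
  (∀ k, CongruentMod (R k) (B k) (powerLattice d (m k))) ∧
    Summable fun k => ((B k \ powerLattice d (m k)).card : ℝ) / (m k : ℝ) ^ d

/-- The cube `[-c, c]^d`. -/
def cube (d : ℕ) (c : ℝ) : Set (Fin d → ℝ) :=
  {x | ∀ i, x i ∈ Set.Icc (-c) c}

/-- The standing conditions on one modulus `m` and one matrix `R`: `m ≥ 2`, `R` is invertible, all
entries of `R` are (integer) multiples of `m`, and `[-m, m]^d ⊆ Rᵀ [-1, 1]^d`. -/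
structure IsDilation {d : ℕ} (m : ℕ) (R : Matrix (Fin d) (Fin d) ℝ) : Prop where
  two_le : 2 ≤ m
  isUnit : IsUnit R
  multiple : ∀ i j, ∃ a : ℤ, R i j = (m : ℝ) * (a : ℝ)
  cube_subset : cube d (m : ℝ) ⊆ (fun x => Rᵀ *ᵥ x) '' cube d 1

end

/-!
Write `T_n` for the dual scaling `x ↦ (R_0⁻¹ ⋯ R_{n-1}⁻¹)ᵀ x`. The hypothesis
`[-m, m]^d ⊆ Rᵀ [-1, 1]^d` says precisely that `R⁻ᵀ` contracts the sup norm by `1 / m`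
(`IsDilation.norm_vecMul_inv_le`); this is used for everything that converges below.

*Existence.* Write the points of `B_k` as `u + R_k z_u` with `u ∈ {0, …, m_k - 1}^d` and draw
independent uniform digits `u`. By the summability hypothesis and the Borel–Cantelli lemma almost
surely only finitely many digits have `z_u ≠ 0`, and the remaining series converges geometrically.
The law of its sum is the infinite convolution (`exists_isInfiniteConvolution`).

*Spectrality.* The Fourier transform of the `k`-th factor at `ξ` is a trigonometric polynomial
(`mask`) in `T_{k+1} ξ` and `T_k ξ`. As the entries of `R_k` are multiples of `m_k`, translating
`T_{k+1} ξ` by `v / m_k` and integers gives an orthonormal system of characters of `(ℤ/m_k)^d`, and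
Parseval's identity (`sum_norm_mask_sq`) yields finite sets `Λ_n ⊆ ℤ^d` (`freqs`) with
`∑_{l ∈ Λ_n} |μ̂_n(ξ + l)|² = 1` for all `ξ` (`sum_norm_prodMask_sq`). The freedom in the choice of
representatives is used to arrange `T_n Λ_n ⊆ [-1/2, 1/2]^d`; because `m_n ≥ 2`, the sets `Λ_n` are
then automatically nested. For such frequencies the factors of index `≥ n` are products of
Dirichlet kernels at points at most about `2⁻ʲ / (2 m_{n+j})`, up to a summable error, so that
their product is bounded below independently of `n` (`eventually_le_norm_prodMask`). Hence
`|μ̂_n(ξ + l)| ≤ C |μ̂(ξ + l)|` on `Λ_n` for large `n`, and dominated convergence gives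
`∑_{l ∈ Λ} |μ̂(ξ + l)|² = 1` for `Λ = ⋃ Λ_n` (`tsum_limit_eq_one`). By the criterion of Jorgensen
and Pedersen (`isSpectrum_of_tsum_eq_one`) this makes `Λ` a spectrum.

*Non-compact support.* For `m_k = 2 ^ (k + 1)` and `R_k = m_k I`, only the digit `0` is moved, by a
vector that the scaling takes to `(k, …, k)`. All terms of the random series are nonnegative, so
its sum has coordinates at least `k` with positive probability, for every `k`.
-/

noncomputable section

/-! ### Characters -/

/-- The character `t ↦ e^{-2πit}` of `ℝ`. -/
def unitChar (t : ℝ) : ℂ := Complex.exp (-2 * Real.pi * Complex.I * (t : ℂ))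

lemma expFun_eq {d : ℕ} (l x : Fin d → ℝ) : expFun l x = unitChar (l ⬝ᵥ x) := rfl

lemma unitChar_add (s t : ℝ) : unitChar (s + t) = unitChar s * unitChar t := by
  simp only [unitChar, ← Complex.exp_add]
  congr 1; push_cast; ring

@[simp] lemma unitChar_zero : unitChar 0 = 1 := by simp [unitChar]

lemma unitChar_eq_exp_mul_I (t : ℝ) :
    unitChar t = Complex.exp (((-(2 * Real.pi * t) : ℝ) : ℂ) * Complex.I) := by
  rw [unitChar]; congr 1; push_cast; ring

@[simp] lemma norm_unitChar (t : ℝ) : ‖unitChar t‖ = 1 := by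
  rw [unitChar_eq_exp_mul_I, Complex.norm_exp_ofReal_mul_I]

lemma unitChar_neg (t : ℝ) : unitChar (-t) = (starRingEnd ℂ) (unitChar t) := by
  rw [unitChar_eq_exp_mul_I, unitChar_eq_exp_mul_I, ← Complex.exp_conj, map_mul, Complex.conj_ofReal,
    Complex.conj_I]
  congr 1; push_cast; ring

lemma unitChar_intCast (n : ℤ) : unitChar n = 1 := by
  rw [unitChar, Complex.exp_eq_one_iff]
  exact ⟨-n, by push_cast; ring⟩

lemma unitChar_sum {ι : Type*} (s : Finset ι) (f : ι → ℝ) :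
    unitChar (∑ i ∈ s, f i) = ∏ i ∈ s, unitChar (f i) := by
  classical
  induction s using Finset.induction_on with
  | empty => simp
  | insert a s ha ih => rw [Finset.sum_insert ha, Finset.prod_insert ha, unitChar_add, ih]

lemma unitChar_re (t : ℝ) : (unitChar t).re = Real.cos (2 * Real.pi * t) := by
  rw [unitChar_eq_exp_mul_I, Complex.exp_ofReal_mul_I_re, Real.cos_neg]

lemma unitChar_nat_mul (n : ℕ) (t : ℝ) : unitChar (n * t) = unitChar t ^ n := by
  rw [unitChar, unitChar, ← Complex.exp_nat_mul]
  congr 1; push_cast; ring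

lemma continuous_unitChar : Continuous unitChar := by
  unfold unitChar; fun_prop

/-! ### Integer vectors -/

/-- The inclusion `ℤ^d → ℝ^d`. -/
def intVec {d : ℕ} (z : Fin d → ℤ) : Fin d → ℝ := fun i => (z i : ℝ)

/-- The digit `u ∈ {0, …, m - 1}^d` as a vector of `ℝ^d`. -/
def digitVec {d m : ℕ} (u : Fin d → Fin m) : Fin d → ℝ := fun i => ((u i : ℕ) : ℝ)

lemma mem_integerLattice {d : ℕ} {x : Fin d → ℝ} :
    x ∈ integerLattice d ↔ ∀ i, ∃ a : ℤ, x i = a := by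
  constructor
  · rintro ⟨z, rfl⟩ i
    exact ⟨z i, rfl⟩
  · intro h
    choose z hz using h
    exact ⟨z, funext fun i => (hz i).symm⟩

lemma intVec_mem {d : ℕ} (z : Fin d → ℤ) : intVec z ∈ integerLattice d := ⟨z, rfl⟩

lemma digitVec_mem {d m : ℕ} (u : Fin d → Fin m) : digitVec u ∈ integerLattice d :=
  mem_integerLattice.2 fun i => ⟨(u i : ℕ), by simp [digitVec]⟩

lemma zero_mem_integerLattice {d : ℕ} : (0 : Fin d → ℝ) ∈ integerLattice d :=
  mem_integerLattice.2 fun _ => ⟨0, by simp⟩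

lemma add_mem_integerLattice {d : ℕ} {x y : Fin d → ℝ} (hx : x ∈ integerLattice d)
    (hy : y ∈ integerLattice d) : x + y ∈ integerLattice d := by
  rw [mem_integerLattice] at *
  intro i
  obtain ⟨a, ha⟩ := hx i
  obtain ⟨b, hb⟩ := hy i
  exact ⟨a + b, by simp [ha, hb]⟩

lemma exists_dotProduct_eq_intCast {d : ℕ} {x y : Fin d → ℝ} (hx : x ∈ integerLattice d)
    (hy : y ∈ integerLattice d) : ∃ a : ℤ, x ⬝ᵥ y = a := by
  obtain ⟨a, rfl⟩ := hx
  obtain ⟨b, rfl⟩ := hy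
  exact ⟨∑ i, a i * b i, by simp [dotProduct]⟩

lemma unitChar_dotProduct_eq_one {d : ℕ} {x y : Fin d → ℝ} (hx : x ∈ integerLattice d)
    (hy : y ∈ integerLattice d) : unitChar (x ⬝ᵥ y) = 1 := by
  obtain ⟨a, ha⟩ := exists_dotProduct_eq_intCast hx hy
  rw [ha, unitChar_intCast]

/-! ### Masks of a single digit set -/

/-- The Fourier transform of the uniform measure on a digit set `{u + R z_u}`, written in the
variables `x = R^{-T} y` and `y`. -/
def mask {d m : ℕ} (z : (Fin d → Fin m) → (Fin d → ℤ)) (x y : Fin d → ℝ) : ℂ :=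
  ((m : ℂ) ^ d)⁻¹ * ∑ u, unitChar (x ⬝ᵥ digitVec u + y ⬝ᵥ intVec (z u))

lemma mask_zero {d m : ℕ} (hm : m ≠ 0) (z : (Fin d → Fin m) → (Fin d → ℤ)) :
    mask z 0 0 = 1 := by
  simp [mask, hm]

lemma mask_add_integer {d m : ℕ} (z : (Fin d → Fin m) → (Fin d → ℤ)) (x y : Fin d → ℝ)
    {a b : Fin d → ℝ} (ha : a ∈ integerLattice d) (hb : b ∈ integerLattice d) :
    mask z (x + a) (y + b) = mask z x y := by
  unfold mask
  congr 1
  refine Finset.sum_congr rfl fun u _ => ?_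
  rw [add_dotProduct, add_dotProduct, unitChar_add, unitChar_add, unitChar_add,
    unitChar_add, unitChar_dotProduct_eq_one ha (digitVec_mem u),
    unitChar_dotProduct_eq_one hb (intVec_mem _)]
  ring

lemma norm_mask_le_one {d m : ℕ} (z : (Fin d → Fin m) → (Fin d → ℤ)) (x y : Fin d → ℝ) :
    ‖mask z x y‖ ≤ 1 := by
  unfold mask
  rw [norm_mul, norm_inv, norm_pow, Complex.norm_natCast]
  have h : ‖∑ u : Fin d → Fin m, unitChar (x ⬝ᵥ digitVec u + y ⬝ᵥ intVec (z u))‖ ≤ (m : ℝ) ^ d := by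
    refine (norm_sum_le _ _).trans ?_
    simp
  calc ((m : ℝ) ^ d)⁻¹ * _ ≤ ((m : ℝ) ^ d)⁻¹ * (m : ℝ) ^ d := by gcongr
    _ ≤ 1 := inv_mul_le_one

lemma sum_unitChar_mul_div {m : ℕ} (hm : m ≠ 0) (a b : Fin m) :
    ∑ v : Fin m, unitChar (((v : ℕ) : ℝ) / m * (((a : ℕ) : ℝ) - ((b : ℕ) : ℝ))) =
      if a = b then (m : ℂ) else 0 := by
  have hm' : (m : ℝ) ≠ 0 := by exact_mod_cast hm
  split_ifs with h
  · subst h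
    simp
  · set t : ℝ := (((a : ℕ) : ℝ) - ((b : ℕ) : ℝ)) / m with ht
    have h1 : ∀ v : Fin m, unitChar (((v : ℕ) : ℝ) / m * (((a : ℕ) : ℝ) - ((b : ℕ) : ℝ))) =
        unitChar t ^ (v : ℕ) := by
      intro v
      rw [← unitChar_nat_mul, ht]
      congr 1; ring
    rw [Finset.sum_congr rfl fun v _ => h1 v, Fin.sum_univ_eq_sum_range (fun v => unitChar t ^ v)]
    have hpow : unitChar t ^ m = 1 := by
      rw [← unitChar_nat_mul, ht, mul_div_cancel₀ _ hm']
      have := unitChar_intCast ((a : ℕ) - (b : ℕ) : ℤ)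
      push_cast at this
      exact this
    have hne : unitChar t ≠ 1 := by
      intro h1
      rw [unitChar, Complex.exp_eq_one_iff] at h1
      obtain ⟨n, hn⟩ := h1
      have hpi : (2 * Real.pi * Complex.I : ℂ) ≠ 0 := Complex.two_pi_I_ne_zero
      have h2 : (t : ℂ) = -(n : ℂ) := by
        have : (2 * Real.pi * Complex.I : ℂ) * (t + n) = 0 := by linear_combination -hn
        have := (mul_eq_zero.1 this).resolve_left hpi
        linear_combination this
      have h3 : t = -(n : ℝ) := by exact_mod_cast h2
      have h4 : ((a : ℕ) : ℝ) - ((b : ℕ) : ℝ) = -(n : ℝ) * m := by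
        rw [← h3, ht, div_mul_cancel₀ _ hm']
      have h5 : ((a : ℕ) : ℤ) - ((b : ℕ) : ℤ) = -n * m := by exact_mod_cast h4
      have ha := a.2
      have hb := b.2
      have h6 : (((a : ℕ) : ℤ) - ((b : ℕ) : ℤ)) = 0 :=
        Int.eq_zero_of_abs_lt_dvd (m := (m : ℤ)) ⟨-n, by rw [h5]; ring⟩ (by rw [abs_lt]; omega)
      exact h (Fin.ext (by omega))
    exact (mul_eq_zero.1 (by rw [geom_sum_mul, hpow, sub_self] :
      (∑ v ∈ Finset.range m, unitChar t ^ v) * (unitChar t - 1) = 0)).resolve_right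
        (sub_ne_zero.2 hne)

lemma sum_unitChar_dotProduct {d m : ℕ} (hm : m ≠ 0) (a b : Fin d → Fin m) :
    ∑ v : Fin d → Fin m, unitChar (((m : ℝ)⁻¹ • digitVec v) ⬝ᵥ (digitVec a - digitVec b)) =
      if a = b then (m : ℂ) ^ d else 0 := by
  have h1 : ∀ v : Fin d → Fin m,
      unitChar (((m : ℝ)⁻¹ • digitVec v) ⬝ᵥ (digitVec a - digitVec b)) =
        ∏ i, unitChar (((v i : ℕ) : ℝ) / m * (((a i : ℕ) : ℝ) - ((b i : ℕ) : ℝ))) := by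
    intro v
    rw [dotProduct, unitChar_sum]
    refine Finset.prod_congr rfl fun i _ => ?_
    congr 1
    simp only [digitVec, Pi.smul_apply, Pi.sub_apply, smul_eq_mul]
    ring
  rw [Finset.sum_congr rfl fun v _ => h1 v, ← Fintype.piFinset_univ,
    ← Finset.prod_univ_sum (fun _ => Finset.univ)
      (fun i (v : Fin m) => unitChar (((v : ℕ) : ℝ) / m * (((a i : ℕ) : ℝ) - ((b i : ℕ) : ℝ)))),
    Finset.prod_congr rfl fun i _ => sum_unitChar_mul_div hm (a i) (b i)]
  split_ifs with h
  · subst h; simp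
  · obtain ⟨i, hi⟩ := Function.ne_iff.1 h
    exact Finset.prod_eq_zero (Finset.mem_univ i) (if_neg hi)

/-- Parseval's identity on `(ℤ/m)^d`; equivalently, `{u + R z_u}` and
`{R^T v / m}` form a Hadamard pair. -/
lemma sum_norm_mask_sq {d m : ℕ} (hm : m ≠ 0) (z : (Fin d → Fin m) → (Fin d → ℤ))
    (x y : Fin d → ℝ) :
    ∑ v : Fin d → Fin m, ‖mask z (x + (m : ℝ)⁻¹ • digitVec v) y‖ ^ 2 = 1 := by
  have hM : ((m : ℂ) ^ d) ≠ 0 := by simp [hm]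
  suffices h : ∑ v : Fin d → Fin m, mask z (x + (m : ℝ)⁻¹ • digitVec v) y *
      (starRingEnd ℂ) (mask z (x + (m : ℝ)⁻¹ • digitVec v) y) = 1 by
    have h2 : ((∑ v : Fin d → Fin m, ‖mask z (x + (m : ℝ)⁻¹ • digitVec v) y‖ ^ 2 : ℝ) : ℂ) = 1 := by
      rw [← h]; push_cast
      exact Finset.sum_congr rfl fun v _ => (Complex.mul_conj' _).symm
    exact_mod_cast h2
  set c : (Fin d → Fin m) → ℂ := fun u => unitChar (x ⬝ᵥ digitVec u + y ⬝ᵥ intVec (z u)) with hc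
  have hcc : ∀ u, c u * (starRingEnd ℂ) (c u) = 1 := by
    intro u; rw [Complex.mul_conj', hc, norm_unitChar]; simp
  have h1 : ∀ v : Fin d → Fin m, mask z (x + (m : ℝ)⁻¹ • digitVec v) y *
      (starRingEnd ℂ) (mask z (x + (m : ℝ)⁻¹ • digitVec v) y) =
      ((m : ℂ) ^ d)⁻¹ * ((m : ℂ) ^ d)⁻¹ * ∑ a, ∑ b, c a * (starRingEnd ℂ) (c b) *
        unitChar (((m : ℝ)⁻¹ • digitVec v) ⬝ᵥ (digitVec a - digitVec b)) := by
    intro v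
    have h2 : mask z (x + (m : ℝ)⁻¹ • digitVec v) y =
        ((m : ℂ) ^ d)⁻¹ * ∑ a, c a * unitChar (((m : ℝ)⁻¹ • digitVec v) ⬝ᵥ digitVec a) := by
      unfold mask
      congr 1
      refine Finset.sum_congr rfl fun u _ => ?_
      rw [hc, ← unitChar_add, add_dotProduct]
      congr 1; ring
    rw [h2, map_mul, map_inv₀, map_pow, map_natCast, map_sum]
    rw [mul_mul_mul_comm, Finset.sum_mul_sum]
    congr 1
    refine Finset.sum_congr rfl fun a _ => Finset.sum_congr rfl fun b _ => ?_
    rw [map_mul, ← unitChar_neg (_ ⬝ᵥ digitVec b), dotProduct_sub, sub_eq_add_neg, unitChar_add]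
    ring
  rw [Finset.sum_congr rfl fun v _ => h1 v, ← Finset.mul_sum, Finset.sum_comm]
  have h3 : ∀ a : Fin d → Fin m, ∑ v : Fin d → Fin m, ∑ b, c a * (starRingEnd ℂ) (c b) *
        unitChar (((m : ℝ)⁻¹ • digitVec v) ⬝ᵥ (digitVec a - digitVec b)) = (m : ℂ) ^ d := by
    intro a
    rw [Finset.sum_comm]
    simp_rw [← Finset.mul_sum, sum_unitChar_dotProduct hm]
    simp [hcc]
  rw [Finset.sum_congr rfl fun a _ => h3 a]
  simp
  field_simp

/-! ### Lower bounds for masks -/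

lemma sum_centered_sq (m : ℕ) :
    ∑ j ∈ Finset.range m, ((j : ℝ) - (m - 1) / 2) ^ 2 = m * ((m : ℝ) ^ 2 - 1) / 12 := by
  have h : ∀ c : ℝ, ∑ j ∈ Finset.range m, ((j : ℝ) - c) ^ 2 =
      m * (m - 1) * (2 * m - 1) / 6 - c * (m * (m - 1)) + m * c ^ 2 := by
    intro c
    induction m with
    | zero => simp
    | succ n ih => rw [Finset.sum_range_succ, ih]; push_cast; ring
  rw [h]; ring

/-- The normalised Dirichlet kernel `m⁻¹ ∑_{j<m} e^{-2πijη}` is at least `1 - π²(mη)²/6` in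
absolute value: recentre the frequencies at their mean and use `cos t ≥ 1 - t²/2`. -/
lemma le_norm_dirichlet {m : ℕ} (hm : m ≠ 0) (η : ℝ) :
    1 - Real.pi ^ 2 * (m * η) ^ 2 / 6 ≤ ‖(m : ℂ)⁻¹ * ∑ j : Fin m, unitChar (η * ((j : ℕ) : ℝ))‖ := by
  have hm' : (0 : ℝ) < m := by exact_mod_cast Nat.pos_of_ne_zero hm
  have h1 : ‖(m : ℂ)⁻¹ * ∑ j : Fin m, unitChar (η * ((j : ℕ) : ℝ))‖ =
      ‖unitChar (-(η * ((m - 1) / 2))) * ((m : ℂ)⁻¹ * ∑ j : Fin m, unitChar (η * ((j : ℕ) : ℝ)))‖ := by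
    rw [norm_mul (unitChar _), norm_unitChar, one_mul]
  have h2 : unitChar (-(η * ((m - 1) / 2))) * ((m : ℂ)⁻¹ * ∑ j : Fin m, unitChar (η * ((j : ℕ) : ℝ))) =
      (((m : ℝ)⁻¹ : ℝ) : ℂ) * ∑ j ∈ Finset.range m, unitChar (η * ((j : ℝ) - (m - 1) / 2)) := by
    rw [Fin.sum_univ_eq_sum_range (fun j : ℕ => unitChar (η * (j : ℝ))), mul_left_comm, Finset.mul_sum]
    push_cast
    congr 1
    refine Finset.sum_congr rfl fun j _ => ?_
    rw [← unitChar_add]; congr 1; ring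
  rw [h1, h2]
  refine le_trans ?_ (Complex.re_le_norm _)
  rw [Complex.re_ofReal_mul, Complex.re_sum]
  have h3 : ∑ j ∈ Finset.range m, (1 - (2 * Real.pi * η) ^ 2 / 2 * ((j : ℝ) - (m - 1) / 2) ^ 2) ≤
      ∑ j ∈ Finset.range m, (unitChar (η * ((j : ℝ) - (m - 1) / 2))).re := by
    refine Finset.sum_le_sum fun j _ => ?_
    rw [unitChar_re]
    refine le_trans (le_of_eq ?_) (Real.one_sub_sq_div_two_le_cos)
    ring
  refine le_trans ?_ (mul_le_mul_of_nonneg_left h3 (by positivity))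
  rw [Finset.sum_sub_distrib, ← Finset.mul_sum, sum_centered_sq]
  simp only [Finset.sum_const, Finset.card_range, nsmul_eq_mul, mul_one]
  have : (m : ℝ)⁻¹ * ((m : ℝ) - (2 * Real.pi * η) ^ 2 / 2 * (m * ((m : ℝ) ^ 2 - 1) / 12)) =
      1 - Real.pi ^ 2 * η ^ 2 * ((m : ℝ) ^ 2 - 1) / 6 := by
    field_simp; ring
  rw [this]
  nlinarith [mul_nonneg (sq_nonneg Real.pi) (sq_nonneg η)]

/-- The mask of the unperturbed digit set `{0, …, m - 1}^d` factors into Dirichlet kernels. -/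
lemma mask_unperturbed {d m : ℕ} (x y : Fin d → ℝ) :
    mask (fun _ : Fin d → Fin m => 0) x y =
      ∏ i, ((m : ℂ)⁻¹ * ∑ j : Fin m, unitChar (x i * ((j : ℕ) : ℝ))) := by
  rw [Finset.prod_mul_distrib, Finset.prod_univ_sum, mask]
  simp only [Fintype.piFinset_univ, Finset.prod_const, Finset.card_univ, Fintype.card_fin, inv_pow]
  congr 1
  refine Finset.sum_congr rfl fun u _ => ?_
  rw [← unitChar_sum]
  congr 1
  have : intVec (0 : Fin d → ℤ) = 0 := by ext; simp [intVec]
  rw [this, dotProduct_zero, add_zero]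
  rfl

lemma le_norm_mask_unperturbed {d m : ℕ} (hm : m ≠ 0) {x : Fin d → ℝ} (y : Fin d → ℝ) {t : ℝ}
    (ht : Real.pi ^ 2 * t ^ 2 / 6 ≤ 1) (hx : ‖x‖ ≤ t / m) :
    (1 - Real.pi ^ 2 * t ^ 2 / 6) ^ d ≤ ‖mask (fun _ : Fin d → Fin m => 0) x y‖ := by
  have hm' : (0 : ℝ) < m := by exact_mod_cast Nat.pos_of_ne_zero hm
  rw [mask_unperturbed, norm_prod]
  have : (1 - Real.pi ^ 2 * t ^ 2 / 6) ^ d = ∏ _i : Fin d, (1 - Real.pi ^ 2 * t ^ 2 / 6) := by simp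
  rw [this]
  refine Finset.prod_le_prod (fun _ _ => by linarith) fun i _ => le_trans ?_ (le_norm_dirichlet hm _)
  have h1 : |m * x i| ≤ t := by
    rw [abs_mul, abs_of_pos hm', mul_comm, ← le_div_iff₀ hm']
    exact (norm_le_pi_norm x i).trans hx
  have h2 : (m * x i) ^ 2 ≤ t ^ 2 := by
    rw [← sq_abs]; gcongr
  have h3 := mul_le_mul_of_nonneg_left h2 (sq_nonneg Real.pi)
  linarith

/-- The proportion of perturbed digits. -/
def perturbedRatio {d m : ℕ} (z : (Fin d → Fin m) → (Fin d → ℤ)) : ℝ :=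
  ((Finset.univ.filter fun u => z u ≠ 0).card : ℝ) / (m : ℝ) ^ d

lemma perturbedRatio_nonneg {d m : ℕ} (z : (Fin d → Fin m) → (Fin d → ℤ)) :
    0 ≤ perturbedRatio z := by unfold perturbedRatio; positivity

lemma norm_mask_sub_unperturbed_le {d m : ℕ} (z : (Fin d → Fin m) → (Fin d → ℤ))
    (x y : Fin d → ℝ) :
    ‖mask z x y - mask (fun _ : Fin d → Fin m => 0) x y‖ ≤ 2 * perturbedRatio z := by
  unfold mask perturbedRatio
  rw [← mul_sub, ← Finset.sum_sub_distrib, norm_mul, norm_inv, norm_pow, Complex.norm_natCast]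
  have : ‖∑ u : Fin d → Fin m, (unitChar (x ⬝ᵥ digitVec u + y ⬝ᵥ intVec (z u)) -
      unitChar (x ⬝ᵥ digitVec u + y ⬝ᵥ intVec 0))‖ ≤
        2 * ((Finset.univ.filter fun u => z u ≠ 0).card : ℝ) := by
    rw [← Finset.sum_filter_add_sum_filter_not Finset.univ (fun u => z u ≠ 0)]
    have h0 : ∑ u with ¬ z u ≠ 0, (unitChar (x ⬝ᵥ digitVec u + y ⬝ᵥ intVec (z u)) -
      unitChar (x ⬝ᵥ digitVec u + y ⬝ᵥ intVec 0)) = 0 := by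
      refine Finset.sum_eq_zero fun u hu => ?_
      have : z u = 0 := by simpa using hu
      rw [this, sub_self]
    rw [h0, add_zero]
    refine (norm_sum_le_of_le (n := fun _ => (2 : ℝ)) _ fun u _ => ?_).trans ?_
    · refine (norm_sub_le _ _).trans ?_
      rw [norm_unitChar, norm_unitChar]; norm_num
    · simp [mul_comm]
  refine (mul_le_mul_of_nonneg_left this (by positivity)).trans (le_of_eq ?_)
  ring

/-! ### Dual scaling -/

lemma IsDilation.isUnit_det {d m : ℕ} {R : Matrix (Fin d) (Fin d) ℝ} (h : IsDilation m R) :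
    IsUnit R.det := (Matrix.isUnit_iff_isUnit_det _).1 h.isUnit

lemma IsDilation.ne_zero {d m : ℕ} {R : Matrix (Fin d) (Fin d) ℝ} (h : IsDilation m R) :
    m ≠ 0 := by have := h.two_le; omega

/-- The inclusion `[-m, m]^d ⊆ Rᵀ [-1, 1]^d` says that `R⁻ᵀ` contracts the sup norm by `1 / m`. -/
lemma IsDilation.norm_vecMul_inv_le {d m : ℕ} {R : Matrix (Fin d) (Fin d) ℝ} (h : IsDilation m R)
    (x : Fin d → ℝ) : ‖x ᵥ* R⁻¹‖ ≤ ‖x‖ / m := by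
  have hm : (0 : ℝ) < m := by exact_mod_cast Nat.pos_of_ne_zero h.ne_zero
  rcases eq_or_ne x 0 with rfl | hx
  · simp
  have hc : 0 < ‖x‖ := norm_pos_iff.2 hx
  have hmem : (m / ‖x‖) • x ∈ cube d (m : ℝ) := by
    intro i
    rw [Set.mem_Icc, ← abs_le, Pi.smul_apply, smul_eq_mul, abs_mul, abs_of_pos (div_pos hm hc), div_mul_eq_mul_div,
      div_le_iff₀ hc]
    exact mul_le_mul_of_nonneg_left (norm_le_pi_norm x i) hm.le
  obtain ⟨y, hy, hyx⟩ := h.cube_subset hmem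
  have hy1 : ‖y‖ ≤ 1 := (pi_norm_le_iff_of_nonneg zero_le_one).2 fun i => abs_le.2 (hy i)
  have hyx' : y ᵥ* R = (m / ‖x‖) • x :=
    (Matrix.mulVec_transpose R y).symm.trans hyx
  have : y = (m / ‖x‖) • (x ᵥ* R⁻¹) := by
    rw [← Matrix.smul_vecMul, ← hyx', Matrix.vecMul_vecMul, Matrix.mul_nonsing_inv _ h.isUnit_det,
      Matrix.vecMul_one]
  rw [this, norm_smul, Real.norm_of_nonneg (div_pos hm hc).le, div_mul_eq_mul_div, div_le_one hc] at hy1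
  rw [le_div_iff₀ hm]
  linarith

lemma IsDilation.inv_smul_vecMul_mem {d m : ℕ} {R : Matrix (Fin d) (Fin d) ℝ} (h : IsDilation m R)
    {w : Fin d → ℝ} (hw : w ∈ integerLattice d) : ((m : ℝ)⁻¹ • w) ᵥ* R ∈ integerLattice d := by
  have hm : (m : ℝ) ≠ 0 := by exact_mod_cast h.ne_zero
  obtain ⟨w, rfl⟩ := hw
  choose a ha using h.multiple
  refine mem_integerLattice.2 fun j => ⟨∑ i, w i * a i j, ?_⟩
  simp only [Matrix.vecMul, dotProduct, Pi.smul_apply, smul_eq_mul, ha]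
  push_cast
  refine Finset.sum_congr rfl fun i _ => ?_
  field_simp

lemma smul_mem_integerLattice {d : ℕ} (m : ℤ) {w : Fin d → ℝ} (hw : w ∈ integerLattice d) :
    (m : ℝ) • w ∈ integerLattice d := by
  obtain ⟨w, rfl⟩ := hw
  exact ⟨fun i => m * w i, by ext i; simp⟩

lemma neg_mem_integerLattice {d : ℕ} {w : Fin d → ℝ} (hw : w ∈ integerLattice d) :
    -w ∈ integerLattice d := by
  simpa using smul_mem_integerLattice (-1) hw

lemma IsDilation.vecMul_mem {d m : ℕ} {R : Matrix (Fin d) (Fin d) ℝ} (h : IsDilation m R)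
    {w : Fin d → ℝ} (hw : w ∈ integerLattice d) : w ᵥ* R ∈ integerLattice d := by
  have hm : (m : ℝ) ≠ 0 := by exact_mod_cast h.ne_zero
  have := h.inv_smul_vecMul_mem (smul_mem_integerLattice (m : ℤ) hw)
  rwa [Int.cast_natCast, smul_smul, inv_mul_cancel₀ hm, one_smul] at this

/-- The matrix `R_0⁻¹ ⋯ R_{n-1}⁻¹`. -/
def prodInv {d : ℕ} (R : ℕ → Matrix (Fin d) (Fin d) ℝ) (n : ℕ) : Matrix (Fin d) (Fin d) ℝ :=
  ((List.range n).map fun j => (R j)⁻¹).prod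

lemma prodInv_zero {d : ℕ} (R : ℕ → Matrix (Fin d) (Fin d) ℝ) : prodInv R 0 = 1 := by
  simp [prodInv]

lemma prodInv_succ {d : ℕ} (R : ℕ → Matrix (Fin d) (Fin d) ℝ) (n : ℕ) :
    prodInv R (n + 1) = prodInv R n * (R n)⁻¹ := by
  simp [prodInv, List.range_succ]

/-- The dual scaling `x ↦ (R_0⁻¹ ⋯ R_{n-1}⁻¹)ᵀ x` on frequencies. -/
def dualScale {d : ℕ} (R : ℕ → Matrix (Fin d) (Fin d) ℝ) (n : ℕ) (x : Fin d → ℝ) : Fin d → ℝ :=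
  x ᵥ* prodInv R n

/-- The inverse of `dualScale`. -/
def dualUnscale {d : ℕ} (R : ℕ → Matrix (Fin d) (Fin d) ℝ) (n : ℕ) (x : Fin d → ℝ) :
    Fin d → ℝ :=
  x ᵥ* (prodInv R n)⁻¹

section Dual

variable {d : ℕ} {m : ℕ → ℕ} {R : ℕ → Matrix (Fin d) (Fin d) ℝ}

lemma isUnit_det_prodInv (hR : ∀ k, IsDilation (m k) (R k)) (n : ℕ) :
    IsUnit (prodInv R n).det := by
  induction n with
  | zero => simp [prodInv_zero]
  | succ n ih =>
    rw [prodInv_succ, Matrix.det_mul]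
    exact ih.mul (Matrix.isUnit_nonsing_inv_det _ (hR n).isUnit_det)

lemma dualScale_zero (x : Fin d → ℝ) : dualScale R 0 x = x := by
  simp [dualScale, prodInv_zero]

lemma dualScale_succ (n : ℕ) (x : Fin d → ℝ) :
    dualScale R (n + 1) x = dualScale R n x ᵥ* (R n)⁻¹ := by
  rw [dualScale, dualScale, prodInv_succ, Matrix.vecMul_vecMul]

lemma dualScale_add (n : ℕ) (x y : Fin d → ℝ) :
    dualScale R n (x + y) = dualScale R n x + dualScale R n y := Matrix.add_vecMul _ _ _

lemma dualScale_sub (n : ℕ) (x y : Fin d → ℝ) :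
    dualScale R n (x - y) = dualScale R n x - dualScale R n y := Matrix.sub_vecMul _ _ _

lemma dualScale_apply_zero (n : ℕ) : dualScale R n 0 = 0 := Matrix.zero_vecMul _

lemma dualScale_succ_vecMul (hR : ∀ k, IsDilation (m k) (R k)) (n : ℕ) (x : Fin d → ℝ) :
    dualScale R (n + 1) x ᵥ* R n = dualScale R n x := by
  rw [dualScale_succ, Matrix.vecMul_vecMul, Matrix.nonsing_inv_mul _ (hR n).isUnit_det,
    Matrix.vecMul_one]

lemma dualScale_dualUnscale (hR : ∀ k, IsDilation (m k) (R k)) (n : ℕ) (x : Fin d → ℝ) :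
    dualScale R n (dualUnscale R n x) = x := by
  rw [dualScale, dualUnscale, Matrix.vecMul_vecMul,
    Matrix.nonsing_inv_mul _ (isUnit_det_prodInv hR n), Matrix.vecMul_one]

lemma dualUnscale_dualScale (hR : ∀ k, IsDilation (m k) (R k)) (n : ℕ) (x : Fin d → ℝ) :
    dualUnscale R n (dualScale R n x) = x := by
  rw [dualScale, dualUnscale, Matrix.vecMul_vecMul,
    Matrix.mul_nonsing_inv _ (isUnit_det_prodInv hR n), Matrix.vecMul_one]

lemma norm_dualScale_succ_le (hR : ∀ k, IsDilation (m k) (R k)) (n : ℕ) (x : Fin d → ℝ) :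
    ‖dualScale R (n + 1) x‖ ≤ ‖dualScale R n x‖ / m n := by
  rw [dualScale_succ]; exact (hR n).norm_vecMul_inv_le _

lemma norm_dualScale_add_le (hR : ∀ k, IsDilation (m k) (R k)) (n k : ℕ) (x : Fin d → ℝ) :
    ‖dualScale R (n + k) x‖ ≤ ‖dualScale R n x‖ / 2 ^ k := by
  induction k with
  | zero => simp
  | succ k ih =>
    have h2 : (2 : ℝ) ≤ m (n + k) := by exact_mod_cast (hR (n + k)).two_le
    calc ‖dualScale R (n + (k + 1)) x‖ ≤ ‖dualScale R (n + k) x‖ / m (n + k) :=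
          norm_dualScale_succ_le hR (n + k) x
      _ ≤ (‖dualScale R n x‖ / 2 ^ k) / 2 := by gcongr
      _ = _ := by rw [pow_succ, div_div]

lemma dualScale_mem_of_le (hR : ∀ k, IsDilation (m k) (R k)) {x : Fin d → ℝ} {n : ℕ}
    (h : dualScale R n x ∈ integerLattice d) {j : ℕ} (hj : j ≤ n) :
    dualScale R j x ∈ integerLattice d := by
  induction n with
  | zero =>
    obtain rfl : j = 0 := by omega
    exact h
  | succ n ih =>
    rcases Nat.lt_or_ge n j with h1 | h1
    · obtain rfl : j = n + 1 := by omega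
      exact h
    · refine ih ?_ h1
      rw [← dualScale_succ_vecMul hR]
      exact (hR n).vecMul_mem h

/-! ### Masks of the finite convolutions -/

/-- The Fourier transform at `ξ` of the `k`-th factor of the convolution. -/
def maskAt (R : ℕ → Matrix (Fin d) (Fin d) ℝ) (z : ∀ k, (Fin d → Fin (m k)) → (Fin d → ℤ))
    (k : ℕ) (ξ : Fin d → ℝ) : ℂ :=
  mask (z k) (dualScale R (k + 1) ξ) (dualScale R k ξ)

/-- The Fourier transform at `ξ` of the convolution of the first `n` factors. -/
def prodMask (R : ℕ → Matrix (Fin d) (Fin d) ℝ) (z : ∀ k, (Fin d → Fin (m k)) → (Fin d → ℤ))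
    (n : ℕ) (ξ : Fin d → ℝ) : ℂ :=
  ∏ k ∈ Finset.range n, maskAt R z k ξ

variable {z : ∀ k, (Fin d → Fin (m k)) → (Fin d → ℤ)}

lemma prodMask_zero (hR : ∀ k, IsDilation (m k) (R k)) (n : ℕ) : prodMask R z n 0 = 1 := by
  refine Finset.prod_eq_one fun k _ => ?_
  rw [maskAt, dualScale_apply_zero, dualScale_apply_zero, mask_zero (hR k).ne_zero]

lemma prodMask_add_of_mem (hR : ∀ k, IsDilation (m k) (R k)) {n : ℕ} (ξ : Fin d → ℝ)
    {a : Fin d → ℝ} (ha : dualScale R n a ∈ integerLattice d) :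
    prodMask R z n (ξ + a) = prodMask R z n ξ := by
  refine Finset.prod_congr rfl fun k hk => ?_
  have hk : k < n := Finset.mem_range.1 hk
  rw [maskAt, dualScale_add, dualScale_add, mask_add_integer _ _ _
    (dualScale_mem_of_le hR ha hk) (dualScale_mem_of_le hR ha hk.le)]
  rfl

/-! ### The frequency sets -/

/-- The representative of `y` modulo `ℤ^d` in `[-1/2, 1/2]^d`. -/
def centered (y : Fin d → ℝ) : Fin d → ℝ := fun i => y i - round (y i)

lemma norm_centered_le (y : Fin d → ℝ) : ‖centered y‖ ≤ 1 / 2 :=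
  (pi_norm_le_iff_of_nonneg (by norm_num)).2 fun _ => abs_sub_round _

lemma centered_eq_self {y : Fin d → ℝ} (hy : ‖y‖ ≤ 1 / 4) : centered y = y := by
  ext i
  have h := abs_le.1 ((norm_le_pi_norm y i).trans hy)
  have : round (y i) = 0 := by
    rw [round_eq, Int.floor_eq_zero_iff]
    constructor <;> [linarith [h.1]; linarith [h.2]]
  simp [centered, this]

/-- The frequency of level `n + 1` obtained from a frequency `l` of level `n` and a digit `v`.
Among all `l + (R_{n-1} ⋯ R_0)ᵀ (R_nᵀ / m_n) (v + m_n k)`, `k ∈ ℤ^d`, it is the one that the dual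
scaling of level `n + 1` maps into `[-1/2, 1/2]^d`. -/
def nextFreq (m : ℕ → ℕ) (R : ℕ → Matrix (Fin d) (Fin d) ℝ) (n : ℕ) (l : Fin d → ℝ)
    (v : Fin d → Fin (m n)) : Fin d → ℝ :=
  dualUnscale R (n + 1) (centered (dualScale R (n + 1) l + (m n : ℝ)⁻¹ • digitVec v))

/-- The spectrum of the convolution of the first `n` factors. -/
def freqs (m : ℕ → ℕ) (R : ℕ → Matrix (Fin d) (Fin d) ℝ) : ℕ → Finset (Fin d → ℝ)
  | 0 => {0}
  | n + 1 => (freqs m R n ×ˢ (Finset.univ : Finset (Fin d → Fin (m n)))).image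
      fun p => nextFreq m R n p.1 p.2

lemma exists_dualScale_succ_nextFreq_sub (hR : ∀ k, IsDilation (m k) (R k)) (n : ℕ)
    (l : Fin d → ℝ) (v : Fin d → Fin (m n)) : ∃ r ∈ integerLattice d,
      dualScale R (n + 1) (nextFreq m R n l v - l) = (m n : ℝ)⁻¹ • digitVec v + r := by
  refine ⟨-intVec fun i => round ((dualScale R (n + 1) l + (m n : ℝ)⁻¹ • digitVec v) i),
    neg_mem_integerLattice (intVec_mem _), ?_⟩
  rw [dualScale_sub, nextFreq, dualScale_dualUnscale hR]
  ext i
  simp [centered, intVec]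
  ring

lemma dualScale_nextFreq_sub_mem (hR : ∀ k, IsDilation (m k) (R k)) (n : ℕ)
    (l : Fin d → ℝ) (v : Fin d → Fin (m n)) :
    dualScale R n (nextFreq m R n l v - l) ∈ integerLattice d := by
  obtain ⟨r, hr, h⟩ := exists_dualScale_succ_nextFreq_sub hR n l v
  rw [← dualScale_succ_vecMul hR, h, Matrix.add_vecMul]
  exact add_mem_integerLattice ((hR n).inv_smul_vecMul_mem (digitVec_mem v))
    ((hR n).vecMul_mem hr)

lemma freqs_subset_integerLattice (hR : ∀ k, IsDilation (m k) (R k)) (n : ℕ) :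
    ∀ l ∈ freqs m R n, l ∈ integerLattice d := by
  induction n with
  | zero =>
    intro l hl
    rw [freqs, Finset.mem_singleton] at hl
    exact hl ▸ zero_mem_integerLattice
  | succ n ih =>
    intro l hl
    obtain ⟨p, hp, rfl⟩ := Finset.mem_image.1 hl
    have h1 := ih p.1 (Finset.mem_product.1 hp).1
    have h2 := dualScale_mem_of_le hR (dualScale_nextFreq_sub_mem hR n p.1 p.2) (Nat.zero_le n)
    rw [dualScale_zero] at h2
    simpa using add_mem_integerLattice h2 h1

lemma norm_dualScale_freqs_le (hR : ∀ k, IsDilation (m k) (R k)) (n : ℕ) :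
    ∀ l ∈ freqs m R n, ‖dualScale R n l‖ ≤ 1 / 2 := by
  intro l hl
  cases n with
  | zero =>
    rw [freqs, Finset.mem_singleton] at hl
    rw [hl, dualScale_apply_zero]; norm_num
  | succ n =>
    obtain ⟨p, hp, rfl⟩ := Finset.mem_image.1 hl
    rw [nextFreq, dualScale_dualUnscale hR]
    exact norm_centered_le _

/-- The frequency sets are nested: a frequency of level `n` is scaled into `[-1/4, 1/4]^d` at the
next level, so that it is its own successor for the digit `0`. -/
lemma freqs_subset_succ (hR : ∀ k, IsDilation (m k) (R k)) (n : ℕ) :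
    freqs m R n ⊆ freqs m R (n + 1) := by
  intro l hl
  have hm : 0 < m n := Nat.pos_of_ne_zero (hR n).ne_zero
  refine Finset.mem_image.2 ⟨(l, fun _ => ⟨0, hm⟩), by simp [hl], ?_⟩
  have h0 : digitVec (fun _ : Fin d => (⟨0, hm⟩ : Fin (m n))) = 0 := by ext; simp [digitVec]
  have h1 : ‖dualScale R (n + 1) l‖ ≤ 1 / 4 := by
    have := norm_dualScale_add_le hR n 1 l
    have := norm_dualScale_freqs_le hR n l hl
    linarith
  simp only [nextFreq, h0, smul_zero, add_zero, centered_eq_self h1, dualUnscale_dualScale hR]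

lemma freqs_mono (hR : ∀ k, IsDilation (m k) (R k)) : Monotone (freqs m R) :=
  monotone_nat_of_le_succ (freqs_subset_succ hR)

/-- If the translates of a nonnegative `φ` with `φ 0 = 1` sum to the constant `1`, then the
translations are pairwise distinct. -/
lemma injOn_of_sum_translates_eq_one {ι G : Type*} [AddGroup G] {s : Finset ι} {g : ι → G}
    {φ : G → ℝ} (h0 : φ 0 = 1) (hφ : ∀ x, 0 ≤ φ x) (h : ∀ x, ∑ i ∈ s, φ (x + g i) = 1) :
    Set.InjOn g s := by
  classical
  intro i hi j hj hij
  by_contra hne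
  have h1 : ∑ k ∈ ({i, j} : Finset ι), φ (-g i + g k) ≤ ∑ k ∈ s, φ (-g i + g k) := by
    refine Finset.sum_le_sum_of_subset_of_nonneg ?_ fun _ _ _ => hφ _
    intro k hk
    rcases Finset.mem_insert.1 hk with rfl | hk
    · exact hi
    · rw [Finset.mem_singleton.1 hk]; exact hj
  rw [h, Finset.sum_pair hne, ← hij, neg_add_cancel, h0] at h1
  norm_num at h1

lemma prodMask_succ_nextFreq (hR : ∀ k, IsDilation (m k) (R k)) (n : ℕ) (ξ l : Fin d → ℝ)
    (v : Fin d → Fin (m n)) :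
    prodMask R z (n + 1) (ξ + nextFreq m R n l v) = prodMask R z n (ξ + l) *
      mask (z n) (dualScale R (n + 1) (ξ + l) + (m n : ℝ)⁻¹ • digitVec v)
        (dualScale R n (ξ + l)) := by
  obtain ⟨r, hr, h⟩ := exists_dualScale_succ_nextFreq_sub hR n l v
  have ha := dualScale_nextFreq_sub_mem hR n l v
  have hsum : ξ + nextFreq m R n l v = (ξ + l) + (nextFreq m R n l v - l) := by abel
  rw [prodMask, Finset.prod_range_succ, ← prodMask, hsum, prodMask_add_of_mem hR _ ha, maskAt,
    dualScale_add _ (ξ + l), dualScale_add _ (ξ + l), h, ← add_assoc, mask_add_integer _ _ _ hr ha]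

/-- The Jorgensen–Pedersen identity for the finite convolutions. -/
lemma sum_norm_prodMask_sq (hR : ∀ k, IsDilation (m k) (R k))
    (z : ∀ k, (Fin d → Fin (m k)) → (Fin d → ℤ)) (n : ℕ) (ξ : Fin d → ℝ) :
    ∑ l ∈ freqs m R n, ‖prodMask R z n (ξ + l)‖ ^ 2 = 1 := by
  induction n generalizing ξ with
  | zero => simp [freqs, prodMask]
  | succ n ih =>
    -- The sum over all pairs is `1`; this also shows that distinct pairs give distinct frequencies.
    have key : ∀ ξ, ∑ p ∈ freqs m R n ×ˢ (Finset.univ : Finset (Fin d → Fin (m n))),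
        ‖prodMask R z (n + 1) (ξ + nextFreq m R n p.1 p.2)‖ ^ 2 = 1 := by
      intro ξ
      rw [Finset.sum_product, ← ih ξ]
      refine Finset.sum_congr rfl fun l _ => ?_
      simp_rw [prodMask_succ_nextFreq hR, norm_mul, mul_pow]
      rw [← Finset.mul_sum, sum_norm_mask_sq (hR n).ne_zero, mul_one]
    rw [freqs, Finset.sum_image]
    · exact key ξ
    · exact injOn_of_sum_translates_eq_one (φ := fun x => ‖prodMask R z (n + 1) x‖ ^ 2)
        (by simp [prodMask_zero hR]) (fun _ => by positivity) key

/-- Distinct frequencies of level `n` are orthogonal for the convolution of the first `n` factors. -/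
lemma prodMask_sub_eq_zero (hR : ∀ k, IsDilation (m k) (R k))
    (z : ∀ k, (Fin d → Fin (m k)) → (Fin d → ℤ)) (n : ℕ) {l l' : Fin d → ℝ}
    (hl : l ∈ freqs m R n) (hl' : l' ∈ freqs m R n) (hne : l ≠ l') :
    prodMask R z n (l - l') = 0 := by
  have h1 : ∑ k ∈ ({l', l} : Finset (Fin d → ℝ)), ‖prodMask R z n (-l' + k)‖ ^ 2 ≤ 1 := by
    rw [← sum_norm_prodMask_sq hR z n (-l')]
    refine Finset.sum_le_sum_of_subset_of_nonneg ?_ fun _ _ _ => by positivity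
    intro k hk
    rcases Finset.mem_insert.1 hk with rfl | hk
    · exact hl'
    · rw [Finset.mem_singleton.1 hk]; exact hl
  rw [Finset.sum_pair hne.symm, neg_add_cancel, prodMask_zero hR, neg_add_eq_sub] at h1
  have h2 : ‖prodMask R z n (l - l')‖ ^ 2 ≤ 0 := by simpa using h1
  have h3 : ‖prodMask R z n (l - l')‖ = 0 := by nlinarith [norm_nonneg (prodMask R z n (l - l'))]
  exact norm_eq_zero.1 h3

end Dual

/-! ### Uniform lower bound for the tails -/

lemma one_sub_sum_le_prod_one_sub {ι : Type*} (s : Finset ι) {a : ι → ℝ} (h0 : ∀ i ∈ s, 0 ≤ a i)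
    (h1 : ∀ i ∈ s, a i ≤ 1) : 1 - ∑ i ∈ s, a i ≤ ∏ i ∈ s, (1 - a i) := by
  classical
  induction s using Finset.induction_on with
  | empty => simp
  | insert i s hi ih =>
    rw [Finset.sum_insert hi, Finset.prod_insert hi]
    have ih := ih (fun j hj => h0 j (Finset.mem_insert_of_mem hj))
      fun j hj => h1 j (Finset.mem_insert_of_mem hj)
    have hs : 0 ≤ ∑ j ∈ s, a j := Finset.sum_nonneg fun j hj => h0 j (Finset.mem_insert_of_mem hj)
    have hi0 := h0 i (Finset.mem_insert_self _ _)
    have hi1 := h1 i (Finset.mem_insert_self _ _)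
    nlinarith [mul_le_mul_of_nonneg_left ih (sub_nonneg.2 hi1), mul_nonneg hi0 hs]

lemma norm_prod_sub_prod_le_sum {ι : Type*} (s : Finset ι) {f g : ι → ℂ}
    (hf : ∀ i ∈ s, ‖f i‖ ≤ 1) (hg : ∀ i ∈ s, ‖g i‖ ≤ 1) :
    ‖∏ i ∈ s, f i - ∏ i ∈ s, g i‖ ≤ ∑ i ∈ s, ‖f i - g i‖ := by
  classical
  induction s using Finset.induction_on with
  | empty => simp
  | insert i s hi ih =>
    rw [Finset.sum_insert hi, Finset.prod_insert hi, Finset.prod_insert hi]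
    have ih := ih (fun j hj => hf j (Finset.mem_insert_of_mem hj))
      fun j hj => hg j (Finset.mem_insert_of_mem hj)
    have hgs : ‖∏ j ∈ s, g j‖ ≤ 1 := by
      rw [norm_prod]
      exact Finset.prod_le_one (fun _ _ => norm_nonneg _)
        fun j hj => hg j (Finset.mem_insert_of_mem hj)
    have hfi := hf i (Finset.mem_insert_self _ _)
    calc ‖f i * ∏ j ∈ s, f j - g i * ∏ j ∈ s, g j‖
        = ‖(f i - g i) * ∏ j ∈ s, g j + f i * (∏ j ∈ s, f j - ∏ j ∈ s, g j)‖ := by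
          congr 1; ring
      _ ≤ ‖f i - g i‖ * ‖∏ j ∈ s, g j‖ + ‖f i‖ * ‖∏ j ∈ s, f j - ∏ j ∈ s, g j‖ := by
          refine (norm_add_le _ _).trans (le_of_eq ?_)
          rw [norm_mul, norm_mul]
      _ ≤ ‖f i - g i‖ * 1 + 1 * ∑ j ∈ s, ‖f j - g j‖ := by gcongr
      _ = _ := by ring

section Tail

variable {d : ℕ} {m : ℕ → ℕ} {R : ℕ → Matrix (Fin d) (Fin d) ℝ}
  {z : ∀ k, (Fin d → Fin (m k)) → (Fin d → ℤ)}

/-- If the frequency `ξ` is scaled into `[-3/5, 3/5]^d` at level `n`, then at level `n + j` it is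
scaled into a cube smaller by `2 ^ j`, and the product of the unperturbed masks stays above `5⁻ᵈ`
because `∑_j π² (3/5)² 4⁻ʲ / 6 < 4/5`. -/
lemma le_norm_prod_unperturbed (hR : ∀ k, IsDilation (m k) (R k)) {n : ℕ} {ξ : Fin d → ℝ}
    (hξ : ‖dualScale R n ξ‖ ≤ 3 / 5) (N : ℕ) :
    (1 / 5 : ℝ) ^ d ≤ ‖∏ j ∈ Finset.range N, mask (fun _ : Fin d → Fin (m (n + j)) => 0)
      (dualScale R (n + j + 1) ξ) (dualScale R (n + j) ξ)‖ := by
  set a : ℕ → ℝ := fun j => Real.pi ^ 2 * (3 / 5 / 2 ^ j) ^ 2 / 6 with ha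
  have hpi : Real.pi ^ 2 < 10 := by
    have := Real.pi_lt_d2
    nlinarith [Real.pi_pos]
  have ha0 : ∀ j, 0 ≤ a j := fun j => by rw [ha]; positivity
  have ha' : ∀ j, a j ≤ 3 / 5 * (1 / 4) ^ j := by
    intro j
    have : a j = Real.pi ^ 2 * (3 / 50) * (1 / 4) ^ j := by
      simp only [ha]
      rw [div_pow, ← pow_mul, mul_comm j 2, pow_mul, one_div, inv_pow]
      norm_num
      ring
    rw [this]
    gcongr
    linarith
  have ha1 : ∀ j, a j ≤ 1 := fun j => (ha' j).trans (by
    have : (1 / 4 : ℝ) ^ j ≤ 1 := pow_le_one₀ (by norm_num) (by norm_num)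
    linarith)
  have hsum : ∑ j ∈ Finset.range N, a j ≤ 4 / 5 := by
    calc ∑ j ∈ Finset.range N, a j ≤ ∑ j ∈ Finset.range N, 3 / 5 * (1 / 4 : ℝ) ^ j :=
          Finset.sum_le_sum fun j _ => ha' j
      _ = 4 / 5 * (1 - (1 / 4 : ℝ) ^ N) := by
          rw [← Finset.mul_sum, geom_sum_eq (by norm_num)]; ring
      _ ≤ 4 / 5 := by
          have : (0 : ℝ) ≤ (1 / 4 : ℝ) ^ N := by positivity
          linarith
  have hprod := one_sub_sum_le_prod_one_sub (Finset.range N) (fun j _ => ha0 j) fun j _ => ha1 j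
  calc (1 / 5 : ℝ) ^ d ≤ (∏ j ∈ Finset.range N, (1 - a j)) ^ d := by
        gcongr; linarith
    _ = ∏ j ∈ Finset.range N, (1 - a j) ^ d := (Finset.prod_pow _ _ _).symm
    _ ≤ _ := by
      rw [norm_prod]
      refine Finset.prod_le_prod (fun j _ => pow_nonneg (sub_nonneg.2 (ha1 j)) _) fun j _ => ?_
      refine le_norm_mask_unperturbed (hR (n + j)).ne_zero _ (ha1 j) ?_
      refine (norm_dualScale_succ_le hR _ _).trans ?_
      have := norm_dualScale_add_le hR n j ξ
      gcongr
      exact this.trans (by gcongr)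

lemma prodMask_add_index (n N : ℕ) (ξ : Fin d → ℝ) :
    prodMask R z (n + N) ξ = prodMask R z n ξ * ∏ j ∈ Finset.range N, maskAt R z (n + j) ξ :=
  Finset.prod_range_add _ _ _

/-- From some level on, the factors of index `≥ n` decrease the product of masks at most by a
constant factor, uniformly in the frequencies that are scaled into `[-3/5, 3/5]^d`. -/
lemma eventually_le_norm_prodMask (hR : ∀ k, IsDilation (m k) (R k))
    (hz : Summable fun k => perturbedRatio (z k)) :
    ∀ᶠ n in atTop, ∀ ξ : Fin d → ℝ, ‖dualScale R n ξ‖ ≤ 3 / 5 → ∀ N,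
      (1 / 5 : ℝ) ^ d / 2 * ‖prodMask R z n ξ‖ ≤ ‖prodMask R z (n + N) ξ‖ := by
  have hpos : (0 : ℝ) < (1 / 5 : ℝ) ^ d / 4 := by positivity
  filter_upwards [(tendsto_sum_nat_add fun k => perturbedRatio (z k)).eventually_lt_const hpos]
    with n hn ξ hξ N
  have hs : Summable fun j => perturbedRatio (z (j + n)) := (summable_nat_add_iff n).2 hz
  have h1 : ∑ j ∈ Finset.range N, perturbedRatio (z (n + j)) ≤ (1 / 5 : ℝ) ^ d / 4 := by
    refine le_trans (le_of_eq ?_)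
      ((hs.sum_le_tsum (Finset.range N) fun _ _ => perturbedRatio_nonneg _).trans hn.le)
    exact Finset.sum_congr rfl fun j _ => by rw [add_comm n j]
  have h2 : ‖∏ j ∈ Finset.range N, maskAt R z (n + j) ξ -
      ∏ j ∈ Finset.range N, mask (fun _ : Fin d → Fin (m (n + j)) => 0)
        (dualScale R (n + j + 1) ξ) (dualScale R (n + j) ξ)‖ ≤ (1 / 5 : ℝ) ^ d / 2 := by
    refine (norm_prod_sub_prod_le_sum _ (fun _ _ => norm_mask_le_one _ _ _)
      fun _ _ => norm_mask_le_one _ _ _).trans ?_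
    refine (Finset.sum_le_sum fun j _ => norm_mask_sub_unperturbed_le (z (n + j)) _ _).trans ?_
    rw [← Finset.mul_sum]
    linarith
  have h3 := le_norm_prod_unperturbed hR hξ N
  have h4 := norm_sub_norm_le (∏ j ∈ Finset.range N, mask (fun _ : Fin d → Fin (m (n + j)) => 0)
        (dualScale R (n + j + 1) ξ) (dualScale R (n + j) ξ))
          (∏ j ∈ Finset.range N, maskAt R z (n + j) ξ)
  rw [norm_sub_rev] at h4
  rw [prodMask_add_index, norm_mul, mul_comm]
  gcongr
  linarith

/-! ### The limit of the Jorgensen–Pedersen identities -/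

/-- The union of the frequency sets of all levels. -/
def spectrumSet (m : ℕ → ℕ) (R : ℕ → Matrix (Fin d) (Fin d) ℝ) : Set (Fin d → ℝ) :=
  ⋃ n, (freqs m R n : Set (Fin d → ℝ))

lemma spectrumSet_countable : (spectrumSet m R).Countable :=
  Set.countable_iUnion fun n => (freqs m R n).countable_toSet

lemma spectrumSet_subset (hR : ∀ k, IsDilation (m k) (R k)) :
    spectrumSet m R ⊆ integerLattice d :=
  Set.iUnion_subset fun n _ hl => freqs_subset_integerLattice hR n _ hl

lemma eventually_mem_freqs (hR : ∀ k, IsDilation (m k) (R k)) {l : Fin d → ℝ}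
    (hl : l ∈ spectrumSet m R) : ∀ᶠ n in atTop, l ∈ freqs m R n := by
  obtain ⟨n, hn⟩ := Set.mem_iUnion.1 hl
  filter_upwards [eventually_ge_atTop n] with k hk using freqs_mono hR hk hn

variable {F : (Fin d → ℝ) → ℂ}

lemma limit_sub_eq_zero (hR : ∀ k, IsDilation (m k) (R k))
    (hF : ∀ ξ, Tendsto (fun n => prodMask R z n ξ) atTop (𝓝 (F ξ))) {l l' : Fin d → ℝ}
    (hl : l ∈ spectrumSet m R) (hl' : l' ∈ spectrumSet m R) (hne : l ≠ l') : F (l - l') = 0 := by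
  refine tendsto_nhds_unique (hF _) (tendsto_const_nhds.congr' ?_)
  filter_upwards [eventually_mem_freqs hR hl, eventually_mem_freqs hR hl'] with n h h'
  exact (prodMask_sub_eq_zero hR z n h h' hne).symm

/-- Every finite partial sum is a limit of partial sums of the identities of level `n`, hence at
most `1`. -/
lemma summable_indicator_limit (hR : ∀ k, IsDilation (m k) (R k))
    (hF : ∀ ξ, Tendsto (fun n => prodMask R z n ξ) atTop (𝓝 (F ξ))) (ξ : Fin d → ℝ) :
    Summable ((spectrumSet m R).indicator fun l => ‖F (ξ + l)‖ ^ 2) := by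
  classical
  refine summable_of_sum_le (c := 1)
    (fun l => Set.indicator_nonneg (fun _ _ => by positivity) _) fun s => ?_
  rw [← Finset.sum_filter_add_sum_filter_not s (fun l => l ∈ spectrumSet m R)]
  rw [Finset.sum_congr rfl fun l hl => Set.indicator_of_mem (Finset.mem_filter.1 hl).2 _,
    Finset.sum_eq_zero fun l hl => Set.indicator_of_notMem (Finset.mem_filter.1 hl).2 _, add_zero]
  set t := s.filter fun l => l ∈ spectrumSet m R
  have hlim : Tendsto (fun n => ∑ l ∈ t, ‖prodMask R z n (ξ + l)‖ ^ 2) atTop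
      (𝓝 (∑ l ∈ t, ‖F (ξ + l)‖ ^ 2)) := tendsto_finsetSum _ fun l _ => ((hF _).norm).pow 2
  refine le_of_tendsto hlim ?_
  have hmem : ∀ᶠ n in atTop, ∀ l ∈ t, l ∈ freqs m R n :=
    (Finset.eventually_all t).2 fun l hl => eventually_mem_freqs hR (Finset.mem_filter.1 hl).2
  filter_upwards [hmem] with n hn
  rw [← sum_norm_prodMask_sq hR z n ξ]
  exact Finset.sum_le_sum_of_subset_of_nonneg hn fun _ _ _ => by positivity

/-- The Jorgensen–Pedersen identity passes to the limit: by the lower bound for the tails the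
terms at level `n` are dominated by a constant multiple of the terms of the limit. -/
lemma tsum_limit_eq_one (hR : ∀ k, IsDilation (m k) (R k))
    (hz : Summable fun k => perturbedRatio (z k))
    (hF : ∀ ξ, Tendsto (fun n => prodMask R z n ξ) atTop (𝓝 (F ξ))) (ξ : Fin d → ℝ) :
    ∑' l : spectrumSet m R, ‖F (ξ + l)‖ ^ 2 = 1 := by
  rw [tsum_subtype (spectrumSet m R) fun l => ‖F (ξ + l)‖ ^ 2]
  set c : ℝ := (1 / 5 : ℝ) ^ d / 2 with hc
  have hc0 : 0 < c := by rw [hc]; positivity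
  have hsumm := summable_indicator_limit hR hF ξ
  have hlim : Tendsto (fun n => ∑' l, (freqs m R n : Set (Fin d → ℝ)).indicator
      (fun l => ‖prodMask R z n (ξ + l)‖ ^ 2) l) atTop
        (𝓝 (∑' l, (spectrumSet m R).indicator (fun l => ‖F (ξ + l)‖ ^ 2) l)) := by
    refine tendsto_tsum_of_dominated_convergence (hsumm.mul_left ((c ^ 2)⁻¹)) (fun l => ?_) ?_
    · by_cases hl : l ∈ spectrumSet m R
      · rw [Set.indicator_of_mem hl]
        refine (((hF (ξ + l)).norm).pow 2).congr' ?_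
        filter_upwards [eventually_mem_freqs hR hl] with n hn
        rw [Set.indicator_of_mem (Finset.mem_coe.2 hn)]
      · rw [Set.indicator_of_notMem hl]
        refine tendsto_const_nhds.congr fun n => ?_
        rw [Set.indicator_of_notMem]
        exact fun h => hl (Set.mem_iUnion.2 ⟨n, h⟩)
    · have hξ : Tendsto (fun n : ℕ => ‖ξ‖ / 2 ^ n) atTop (𝓝 0) :=
        tendsto_const_nhds.div_atTop (tendsto_pow_atTop_atTop_of_one_lt one_lt_two)
      filter_upwards [eventually_le_norm_prodMask hR hz,
        hξ.eventually_lt_const (show (0 : ℝ) < 1 / 10 by norm_num)] with n hn hξn l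
      by_cases hl : l ∈ freqs m R n
      · have hl' : l ∈ spectrumSet m R := Set.mem_iUnion.2 ⟨n, hl⟩
        rw [Set.indicator_of_mem (Finset.mem_coe.2 hl), Set.indicator_of_mem hl',
          Real.norm_of_nonneg (by positivity)]
        -- `3 / 5 = 1 / 2 + 1 / 10`: the scaled `l` contributes `1 / 2`, the scaled `ξ` the rest.
        have h1 : ‖dualScale R n (ξ + l)‖ ≤ 3 / 5 := by
          rw [dualScale_add]
          refine (norm_add_le _ _).trans ?_
          have h2 := norm_dualScale_add_le hR 0 n ξ
          rw [zero_add, dualScale_zero] at h2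
          have h3 := norm_dualScale_freqs_le hR n l hl
          linarith
        have h2 : c * ‖prodMask R z n (ξ + l)‖ ≤ ‖F (ξ + l)‖ := by
          refine ge_of_tendsto ((hF (ξ + l)).norm) ?_
          filter_upwards [eventually_ge_atTop n] with k hk
          obtain ⟨N, rfl⟩ := Nat.exists_eq_add_of_le hk
          exact hn _ h1 N
        rw [le_inv_mul_iff₀ (by positivity), ← mul_pow]
        gcongr
      · rw [Set.indicator_of_notMem (by simpa using hl), norm_zero]
        exact mul_nonneg (by positivity) (Set.indicator_nonneg (fun _ _ => by positivity) _)
  refine tendsto_nhds_unique hlim (tendsto_const_nhds.congr fun n => ?_)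
  rw [tsum_eq_sum (s := freqs m R n) fun l hl => Set.indicator_of_notMem (by simpa using hl) _,
    Finset.sum_congr rfl fun l hl => Set.indicator_of_mem (Finset.mem_coe.2 hl) _,
    sum_norm_prodMask_sq hR z n ξ]

end Tail

/-! ### Fourier transforms of measures -/

/-- The Fourier transform of a measure. -/
def fourierMeasure {d : ℕ} (μ : Measure (Fin d → ℝ)) (ξ : Fin d → ℝ) : ℂ :=
  ∫ x, expFun ξ x ∂μ

lemma continuous_expFun {d : ℕ} (ξ : Fin d → ℝ) : Continuous (expFun ξ) := by
  have : Continuous fun x : Fin d → ℝ => ξ ⬝ᵥ x := by unfold dotProduct; fun_prop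
  exact continuous_unitChar.comp this

lemma norm_expFun {d : ℕ} (ξ x : Fin d → ℝ) : ‖expFun ξ x‖ = 1 := norm_unitChar _

lemma expFun_add_right {d : ℕ} (ξ x y : Fin d → ℝ) :
    expFun ξ (x + y) = expFun ξ x * expFun ξ y := by
  rw [expFun_eq, dotProduct_add, unitChar_add]; rfl

lemma expFun_sub_left {d : ℕ} (ξ η x : Fin d → ℝ) :
    expFun (ξ - η) x = expFun ξ x * (starRingEnd ℂ) (expFun η x) := by
  rw [expFun_eq, sub_dotProduct, sub_eq_add_neg, unitChar_add, unitChar_neg]; rfl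

lemma expFun_neg_left {d : ℕ} (ξ x : Fin d → ℝ) :
    expFun (-ξ) x = (starRingEnd ℂ) (expFun ξ x) := by
  rw [expFun_eq, neg_dotProduct, unitChar_neg]; rfl

lemma integrable_expFun {d : ℕ} (μ : Measure (Fin d → ℝ)) [IsFiniteMeasure μ] (ξ : Fin d → ℝ) :
    Integrable (expFun ξ) μ :=
  Integrable.of_bound (continuous_expFun ξ).aestronglyMeasurable 1
    (ae_of_all _ fun x => (norm_expFun ξ x).le)

lemma fourierMeasure_conv {d : ℕ} (μ ν : Measure (Fin d → ℝ)) [IsFiniteMeasure μ]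
    [IsFiniteMeasure ν] (ξ : Fin d → ℝ) :
    fourierMeasure (μ.conv ν) ξ = fourierMeasure μ ξ * fourierMeasure ν ξ := by
  unfold fourierMeasure
  rw [Measure.conv, integral_map (by fun_prop) (continuous_expFun ξ).aestronglyMeasurable]
  simp_rw [expFun_add_right]
  exact integral_prod_mul _ _

lemma fourierMeasure_neg {d : ℕ} (μ : Measure (Fin d → ℝ)) (ξ : Fin d → ℝ) :
    fourierMeasure μ (-ξ) = (starRingEnd ℂ) (fourierMeasure μ ξ) := by
  unfold fourierMeasure
  simp_rw [expFun_neg_left]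
  exact integral_conj

/-! ### The factors of the convolution -/

section Factors

variable {d : ℕ} {m : ℕ → ℕ} {R : ℕ → Matrix (Fin d) (Fin d) ℝ}
  {B : ℕ → Finset (Fin d → ℝ)} {z : ∀ k, (Fin d → Fin (m k)) → (Fin d → ℤ)}

/-- The point `u + R_k z_u` of the digit set `B_k`. -/
def digitPoint (R : ℕ → Matrix (Fin d) (Fin d) ℝ) (z : ∀ k, (Fin d → Fin (m k)) → (Fin d → ℤ))
    (k : ℕ) (u : Fin d → Fin (m k)) : Fin d → ℝ :=
  digitVec u + R k *ᵥ intVec (z k u)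

/-- The point `R_0⁻¹ ⋯ R_k⁻¹ (u + R_k z_u)` of the support of the `k`-th factor. -/
def scaledPoint (R : ℕ → Matrix (Fin d) (Fin d) ℝ) (z : ∀ k, (Fin d → Fin (m k)) → (Fin d → ℤ))
    (k : ℕ) (u : Fin d → Fin (m k)) : Fin d → ℝ :=
  invProd R k *ᵥ digitPoint R z k u

lemma powerLattice_eq (d m : ℕ) :
    powerLattice d m = Finset.univ.image (digitVec : (Fin d → Fin m) → Fin d → ℝ) := rfl

lemma exists_digits (h : ∀ k, CongruentMod (R k) (B k) (powerLattice d (m k))) :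
    ∃ z : ∀ k, (Fin d → Fin (m k)) → (Fin d → ℤ),
      ∀ k, B k = Finset.univ.image (digitPoint R z k) := by
  choose z hz using h
  refine ⟨fun k u => z k (digitVec u), fun k => ?_⟩
  rw [hz k, powerLattice_eq, Finset.image_image]
  rfl

/-- Distinct digits stay distinct modulo `R_k ℤ^d`, as the entries of `R_k` are multiples
of `m_k`. -/
lemma digitVec_eq_of_sub_mem {m : ℕ} {R : Matrix (Fin d) (Fin d) ℝ} (hR : IsDilation m R)
    {u v : Fin d → Fin m} {w : Fin d → ℤ} (h : digitVec u - digitVec v = R *ᵥ intVec w) :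
    u = v := by
  choose a ha using hR.multiple
  ext i
  have h1 := congrFun h i
  simp only [digitVec, Pi.sub_apply, Matrix.mulVec, dotProduct, intVec, ha, mul_assoc] at h1
  rw [← Finset.mul_sum] at h1
  have h2 : ((u i : ℕ) : ℤ) - ((v i : ℕ) : ℤ) = (m : ℤ) * ∑ j, a i j * w j := by
    exact_mod_cast h1
  have hu := (u i).2
  have hv := (v i).2
  have h6 : (((u i : ℕ) : ℤ) - ((v i : ℕ) : ℤ)) = 0 :=
    Int.eq_zero_of_abs_lt_dvd (m := (m : ℤ)) ⟨_, h2⟩ (by rw [abs_lt]; omega)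
  omega

lemma digitPoint_injective (hR : ∀ k, IsDilation (m k) (R k))
    (z : ∀ k, (Fin d → Fin (m k)) → (Fin d → ℤ)) (k : ℕ) :
    Function.Injective (digitPoint R z k) := by
  intro u v h
  refine digitVec_eq_of_sub_mem (hR k) (w := z k v - z k u) ?_
  have : intVec (z k v - z k u) = intVec (z k v) - intVec (z k u) := by ext; simp [intVec]
  rw [this, Matrix.mulVec_sub, sub_eq_sub_iff_add_eq_add]
  exact h.trans (add_comm _ _)

lemma scaledPoint_injective (hR : ∀ k, IsDilation (m k) (R k))
    (z : ∀ k, (Fin d → Fin (m k)) → (Fin d → ℤ)) (k : ℕ) :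
    Function.Injective (scaledPoint R z k) := by
  refine Function.Injective.comp (g := fun x => invProd R k *ᵥ x) ?_ (digitPoint_injective hR z k)
  refine Matrix.mulVec_injective_of_isUnit ?_
  rw [Matrix.isUnit_iff_isUnit_det]
  exact isUnit_det_prodInv hR (k + 1)

lemma scaledDigits_eq (hB : ∀ k, B k = Finset.univ.image (digitPoint R z k)) (k : ℕ) :
    scaledDigits R B k = Finset.univ.image (scaledPoint R z k) := by
  rw [scaledDigits, hB k, Finset.image_image]; rfl

lemma uniformDirac_scaledDigits (hR : ∀ k, IsDilation (m k) (R k))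
    (hB : ∀ k, B k = Finset.univ.image (digitPoint R z k)) (k : ℕ) :
    uniformDirac (scaledDigits R B k) =
      ((m k : ENNReal) ^ d)⁻¹ • ∑ u, Measure.dirac (scaledPoint R z k u) := by
  have hinj := scaledPoint_injective hR z k
  rw [scaledDigits_eq hB, uniformDirac, Finset.card_image_of_injective _ hinj,
    Finset.sum_image hinj.injOn]
  simp

lemma dotProduct_scaledPoint (hR : ∀ k, IsDilation (m k) (R k)) (k : ℕ) (u : Fin d → Fin (m k))
    (ξ : Fin d → ℝ) : ξ ⬝ᵥ scaledPoint R z k u =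
      dualScale R (k + 1) ξ ⬝ᵥ digitVec u + dualScale R k ξ ⬝ᵥ intVec (z k u) := by
  have h : invProd R k = prodInv R (k + 1) := rfl
  rw [scaledPoint, h, Matrix.dotProduct_mulVec, digitPoint, dotProduct_add]
  change _ + dualScale R (k + 1) ξ ⬝ᵥ _ = _
  rw [Matrix.dotProduct_mulVec, dualScale_succ_vecMul hR]
  rfl

lemma fourierMeasure_uniformDirac (hR : ∀ k, IsDilation (m k) (R k))
    (hB : ∀ k, B k = Finset.univ.image (digitPoint R z k)) (k : ℕ) (ξ : Fin d → ℝ) :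
    fourierMeasure (uniformDirac (scaledDigits R B k)) ξ = maskAt R z k ξ := by
  rw [uniformDirac_scaledDigits hR hB, fourierMeasure, integral_smul_measure,
    integral_finsetSum_measure fun u _ => integrable_expFun _ ξ]
  simp only [integral_dirac, expFun_eq, dotProduct_scaledPoint hR]
  rw [maskAt, mask, Complex.real_smul]
  simp

lemma isProbabilityMeasure_uniformDirac (hR : ∀ k, IsDilation (m k) (R k))
    (hB : ∀ k, B k = Finset.univ.image (digitPoint R z k)) (k : ℕ) :
    IsProbabilityMeasure (uniformDirac (scaledDigits R B k)) := by
  rw [uniformDirac_scaledDigits hR hB]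
  constructor
  have h0 : ((m k : ENNReal) ^ d) ≠ 0 := pow_ne_zero _ (by exact_mod_cast (hR k).ne_zero)
  have h1 : ((m k : ENNReal) ^ d) ≠ ⊤ := ENNReal.pow_ne_top (ENNReal.natCast_ne_top _)
  simp [ENNReal.inv_mul_cancel h0 h1]

lemma isProbabilityMeasure_finiteConvolution (hR : ∀ k, IsDilation (m k) (R k))
    (hB : ∀ k, B k = Finset.univ.image (digitPoint R z k)) (n : ℕ) :
    IsProbabilityMeasure (finiteConvolution R B n) := by
  induction n with
  | zero => rw [finiteConvolution]; infer_instance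
  | succ n ih =>
    have := isProbabilityMeasure_uniformDirac hR hB n
    rw [finiteConvolution]; infer_instance

lemma fourierMeasure_finiteConvolution (hR : ∀ k, IsDilation (m k) (R k))
    (hB : ∀ k, B k = Finset.univ.image (digitPoint R z k)) (n : ℕ) (ξ : Fin d → ℝ) :
    fourierMeasure (finiteConvolution R B n) ξ = prodMask R z n ξ := by
  induction n with
  | zero => simp [finiteConvolution, fourierMeasure, prodMask, expFun]
  | succ n ih =>
    have := isProbabilityMeasure_uniformDirac hR hB n
    have := isProbabilityMeasure_finiteConvolution hR hB n
    rw [finiteConvolution, fourierMeasure_conv, ih, fourierMeasure_uniformDirac hR hB, prodMask,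
      prodMask, Finset.prod_range_succ]

lemma tendsto_prodMask (hR : ∀ k, IsDilation (m k) (R k))
    (hB : ∀ k, B k = Finset.univ.image (digitPoint R z k))
    {μ : ProbabilityMeasure (Fin d → ℝ)} (hμ : IsInfiniteConvolution R B μ) (ξ : Fin d → ℝ) :
    Tendsto (fun n => prodMask R z n ξ) atTop (𝓝 (fourierMeasure (μ : Measure (Fin d → ℝ)) ξ)) := by
  have hre : Continuous fun x => (expFun ξ x).re := Complex.continuous_re.comp (continuous_expFun ξ)
  have him : Continuous fun x => (expFun ξ x).im := Complex.continuous_im.comp (continuous_expFun ξ)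
  have h1 := hμ (BoundedContinuousFunction.ofNormedAddCommGroup _ hre 1 fun x =>
    (Complex.abs_re_le_norm _).trans (norm_expFun ξ x).le)
  have h2 := hμ (BoundedContinuousFunction.ofNormedAddCommGroup _ him 1 fun x =>
    (Complex.abs_im_le_norm _).trans (norm_expFun ξ x).le)
  have key : ∀ (ν : Measure (Fin d → ℝ)) [IsProbabilityMeasure ν], fourierMeasure ν ξ =
      ((∫ x, (expFun ξ x).re ∂ν : ℝ) : ℂ) + ((∫ x, (expFun ξ x).im ∂ν : ℝ) : ℂ) * Complex.I :=
    fun ν _ => (integral_re_add_im (integrable_expFun ν ξ)).symm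
  simp_rw [← fourierMeasure_finiteConvolution hR hB]
  rw [key]
  refine Tendsto.congr (fun n => ?_) (((Complex.continuous_ofReal.tendsto _).comp h1).add
    (((Complex.continuous_ofReal.tendsto _).comp h2).mul_const Complex.I))
  have := isProbabilityMeasure_finiteConvolution hR hB n
  exact (key _).symm

/-- The perturbed digits correspond to the points of `B_k` outside `{0, …, m_k - 1}^d`. -/
lemma card_sdiff_powerLattice (hR : ∀ k, IsDilation (m k) (R k))
    (hB : ∀ k, B k = Finset.univ.image (digitPoint R z k)) (k : ℕ) :
    ((B k \ powerLattice d (m k)).card : ℝ) / (m k : ℝ) ^ d = perturbedRatio (z k) := by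
  unfold perturbedRatio
  congr 2
  have h : B k \ powerLattice d (m k) =
      (Finset.univ.filter fun u => z k u ≠ 0).image (digitPoint R z k) := by
    rw [hB k, powerLattice_eq]
    ext x
    simp only [Finset.mem_sdiff, Finset.mem_image, Finset.mem_univ, true_and, Finset.mem_filter]
    constructor
    · rintro ⟨⟨u, rfl⟩, h⟩
      refine ⟨u, fun h0 => h ⟨u, ?_⟩, rfl⟩
      have : intVec (0 : Fin d → ℤ) = 0 := by ext; simp [intVec]
      rw [digitPoint, h0, this, Matrix.mulVec_zero, add_zero]
    · rintro ⟨u, hu, rfl⟩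
      refine ⟨⟨u, rfl⟩, ?_⟩
      rintro ⟨v, hv⟩
      have h1 : digitVec v - digitVec u = R k *ᵥ intVec (z k u) := by
        rw [hv, digitPoint, add_sub_cancel_left]
      obtain rfl := digitVec_eq_of_sub_mem (hR k) h1
      rw [sub_self] at h1
      have h2 : intVec (z k v) = 0 := by
        have hinj := Matrix.mulVec_injective_of_isUnit (hR k).isUnit
        exact hinj (by rw [← h1, Matrix.mulVec_zero])
      exact hu (funext fun i => by simpa [intVec] using congrFun h2 i)
  rw [h, Finset.card_image_of_injective _ (digitPoint_injective hR z k)]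

end Factors

/-! ### Exponentials span `L²(μ)` -/

/-- Every continuous character of `ℝ^d` is one of the exponentials. -/
lemma exists_exp_eq_expFun {d : ℕ} (L : StrongDual ℝ (Fin d → ℝ)) :
    ∃ ξ : Fin d → ℝ, ∀ x, Complex.exp (L x * Complex.I) = expFun ξ x := by
  refine ⟨fun i => -(2 * Real.pi)⁻¹ * L (Pi.single i 1), fun x => ?_⟩
  have hpi : (2 * Real.pi) ≠ 0 := by positivity
  have h1 : L x = ∑ i, x i * L (Pi.single i 1) := by
    conv_lhs => rw [pi_eq_sum_univ' x]
    simp [map_sum]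
  rw [expFun_eq, unitChar_eq_exp_mul_I]
  congr 3
  rw [h1, dotProduct, Finset.mul_sum, ← Finset.sum_neg_distrib]
  refine Finset.sum_congr rfl fun i _ => ?_
  field_simp

/-- A real integrable function whose Fourier transform vanishes is zero: the measures with
densities `u⁺` and `u⁻` have the same characteristic function. -/
lemma ae_eq_zero_of_forall_integral_expFun_ofReal {d : ℕ} {μ : Measure (Fin d → ℝ)}
    [IsFiniteMeasure μ] {u : (Fin d → ℝ) → ℝ} (hu : Integrable u μ)
    (h : ∀ ξ, ∫ x, expFun ξ x * (u x : ℂ) ∂μ = 0) : u =ᵐ[μ] 0 := by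
  have hmp : AEMeasurable (fun x => ENNReal.ofReal (u x)) μ := hu.aemeasurable.ennreal_ofReal
  have hmn : AEMeasurable (fun x => ENNReal.ofReal (-u x)) μ := hu.neg.aemeasurable.ennreal_ofReal
  have hfp : ∫⁻ x, ENNReal.ofReal (u x) ∂μ ≠ ⊤ := hu.lintegral_lt_top.ne
  have hfn : ∫⁻ x, ENNReal.ofReal (-u x) ∂μ ≠ ⊤ := hu.neg.lintegral_lt_top.ne
  have := isFiniteMeasure_withDensity hfp
  have := isFiniteMeasure_withDensity hfn
  have hint : ∀ (ξ : Fin d → ℝ) {w : (Fin d → ℝ) → ℝ}, Integrable w μ →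
      Integrable (fun x => w x • expFun ξ x) μ := by
    intro ξ w hw
    refine hw.smul_bdd 1 (continuous_expFun ξ).aestronglyMeasurable ?_
    exact ae_of_all _ fun x => (norm_expFun ξ x).le
  have heq : μ.withDensity (fun x => ENNReal.ofReal (u x)) =
      μ.withDensity (fun x => ENNReal.ofReal (-u x)) := by
    refine Measure.ext_of_charFunDual (funext fun L => ?_)
    obtain ⟨ξ, hξ⟩ := exists_exp_eq_expFun L
    simp_rw [charFunDual_apply, hξ]
    rw [integral_withDensity_eq_integral_toReal_smul₀ hmp (ae_of_all _ fun _ => ENNReal.ofReal_lt_top),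
      integral_withDensity_eq_integral_toReal_smul₀ hmn (ae_of_all _ fun _ => ENNReal.ofReal_lt_top),
      ← sub_eq_zero]
    simp only [ENNReal.toReal_ofReal']
    rw [← integral_sub (hint ξ hu.pos_part) (hint ξ hu.neg_part), ← h ξ]
    refine integral_congr_ae (ae_of_all _ fun x => ?_)
    simp only [Complex.real_smul]
    rw [← sub_mul, mul_comm, ← Complex.ofReal_sub,
      max_zero_sub_max_neg_zero_eq_self]
  filter_upwards [(withDensity_eq_iff hmp hmn hfp).1 heq] with x hx
  rcases le_total (u x) 0 with h0 | h0
  · rw [ENNReal.ofReal_of_nonpos h0, eq_comm, ENNReal.ofReal_eq_zero] at hx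
    exact le_antisymm h0 (neg_nonpos.1 hx)
  · rw [ENNReal.ofReal_of_nonpos (neg_nonpos.2 h0), ENNReal.ofReal_eq_zero] at hx
    exact le_antisymm hx h0

lemma ae_eq_zero_of_forall_integral_expFun {d : ℕ} {μ : Measure (Fin d → ℝ)} [IsFiniteMeasure μ]
    {f : (Fin d → ℝ) → ℂ} (hf : Integrable f μ) (h : ∀ ξ, ∫ x, expFun ξ x * f x ∂μ = 0) :
    f =ᵐ[μ] 0 := by
  have hint : ∀ (ξ : Fin d → ℝ) {w : (Fin d → ℝ) → ℂ}, Integrable w μ →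
      Integrable (fun x => expFun ξ x * w x) μ := by
    intro ξ w hw
    refine hw.bdd_mul (c := 1) (continuous_expFun ξ).aestronglyMeasurable ?_
    exact ae_of_all _ fun x => (norm_expFun ξ x).le
  have hconj : Integrable (fun x => (starRingEnd ℂ) (f x)) μ :=
    Complex.conjCLE.toContinuousLinearMap.integrable_comp hf
  have h' : ∀ ξ, ∫ x, expFun ξ x * (starRingEnd ℂ) (f x) ∂μ = 0 := by
    intro ξ
    have h1 := congrArg (starRingEnd ℂ) (h (-ξ))
    rw [← integral_conj, map_zero] at h1
    rw [← h1]
    refine integral_congr_ae (ae_of_all _ fun x => ?_)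
    simp [expFun_neg_left]
  -- The real and imaginary parts of `f` are combinations of `f` and its conjugate.
  have hre := ae_eq_zero_of_forall_integral_expFun_ofReal hf.re fun ξ => by
    have h1 : ∀ x, expFun ξ x * ((RCLike.re (f x) : ℝ) : ℂ) =
        (2 : ℂ)⁻¹ * (expFun ξ x * f x + expFun ξ x * (starRingEnd ℂ) (f x)) := by
      intro x
      rw [← mul_add, Complex.add_conj, RCLike.re_eq_complex_re]
      push_cast; ring
    simp_rw [h1]
    rw [integral_const_mul, integral_add (hint ξ hf) (hint ξ hconj), h, h']
    simp
  have him := ae_eq_zero_of_forall_integral_expFun_ofReal hf.im fun ξ => by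
    have h1 : ∀ x, expFun ξ x * ((RCLike.im (f x) : ℝ) : ℂ) =
        (2 * Complex.I : ℂ)⁻¹ * (expFun ξ x * f x - expFun ξ x * (starRingEnd ℂ) (f x)) := by
      intro x
      rw [← mul_sub, Complex.sub_conj, RCLike.im_eq_complex_im]
      push_cast
      field_simp
    simp_rw [h1]
    rw [integral_const_mul, integral_sub (hint ξ hf) (hint ξ hconj), h, h']
    simp
  filter_upwards [hre, him] with x h1 h2
  exact Complex.ext h1 h2

/-! ### The Jorgensen–Pedersen criterion -/

/-- If Bessel's inequality for `x` is an equality, then `x` is orthogonal to everything that the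
orthonormal family is orthogonal to: adjoin the normalised `f` to the family and apply Bessel's
inequality again. -/
lemma Orthonormal.inner_eq_zero_of_tsum_eq {E ι : Type*} [NormedAddCommGroup E]
    [InnerProductSpace ℂ E] {v : ι → E} (hv : Orthonormal ℂ v) {x : E}
    (hx : ∑' i, ‖inner ℂ (v i) x‖ ^ 2 = ‖x‖ ^ 2) {f : E} (hf : ∀ i, inner ℂ (v i) f = 0) :
    inner ℂ f x = 0 := by
  rcases eq_or_ne f 0 with rfl | hf0
  · simp
  set g : E := ((‖f‖ : ℂ)⁻¹) • f with hg
  have hn : ‖g‖ = 1 := norm_smul_inv_norm hf0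
  have hvg : ∀ i, inner ℂ (v i) g = 0 := fun i => by rw [hg, inner_smul_right, hf, mul_zero]
  have hw : Orthonormal ℂ (fun o : Option ι => o.elim g v) := by
    refine ⟨?_, ?_⟩
    · rintro (_ | i)
      · exact hn
      · exact hv.1 i
    · rintro (_ | i) (_ | j) hij
      · exact absurd rfl hij
      · exact inner_eq_zero_symm.1 (hvg j)
      · exact hvg i
      · exact hv.2 fun h => hij (congrArg some h)
  have hle : ∀ s : Finset ι, ∑ i ∈ s, ‖inner ℂ (v i) x‖ ^ 2 ≤ ‖x‖ ^ 2 - ‖inner ℂ g x‖ ^ 2 := by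
    intro s
    have := hw.sum_inner_products_le (x := x) (s := s.insertNone)
    rw [Finset.sum_insertNone] at this
    simp only [Option.elim] at this
    linarith
  have h1 := hv.inner_products_summable x
  have h2 := h1.tsum_le_of_sum_le hle
  rw [hx] at h2
  have h3 : ‖inner ℂ g x‖ = 0 := by nlinarith [norm_nonneg (inner ℂ g x)]
  rw [norm_eq_zero, hg, inner_smul_left] at h3
  refine (mul_eq_zero.1 h3).resolve_left ?_
  simpa using hf0

lemma memLp_expFun {d : ℕ} (μ : Measure (Fin d → ℝ)) [IsFiniteMeasure μ] (ξ : Fin d → ℝ) :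
    MemLp (expFun ξ) 2 μ :=
  MemLp.of_bound (continuous_expFun ξ).aestronglyMeasurable 1
    (ae_of_all _ fun x => (norm_expFun ξ x).le)

/-- The exponential with frequency `ξ` as an element of `L²(μ)`. -/
def expLp {d : ℕ} (μ : Measure (Fin d → ℝ)) [IsFiniteMeasure μ] (ξ : Fin d → ℝ) : Lp ℂ 2 μ :=
  (memLp_expFun μ ξ).toLp _

lemma coeFn_expLp {d : ℕ} (μ : Measure (Fin d → ℝ)) [IsFiniteMeasure μ] (ξ : Fin d → ℝ) :
    (expLp μ ξ : (Fin d → ℝ) → ℂ) =ᵐ[μ] expFun ξ := MemLp.coeFn_toLp _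

lemma inner_expLp {d : ℕ} (μ : Measure (Fin d → ℝ)) [IsFiniteMeasure μ] (ξ : Fin d → ℝ)
    (f : Lp ℂ 2 μ) : inner ℂ (expLp μ ξ) f = ∫ x, expFun (-ξ) x * f x ∂μ := by
  rw [L2.inner_def]
  refine integral_congr_ae ?_
  filter_upwards [coeFn_expLp μ ξ] with x hx
  rw [hx, RCLike.inner_apply, expFun_neg_left, mul_comm]

lemma inner_expLp_expLp {d : ℕ} (μ : Measure (Fin d → ℝ)) [IsFiniteMeasure μ]
    (ξ η : Fin d → ℝ) : inner ℂ (expLp μ ξ) (expLp μ η) = fourierMeasure μ (η - ξ) := by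
  rw [inner_expLp]
  refine integral_congr_ae ?_
  filter_upwards [coeFn_expLp μ η] with x hx
  rw [hx, expFun_neg_left, expFun_sub_left, mul_comm]

lemma fourierMeasure_zero {d : ℕ} (μ : Measure (Fin d → ℝ)) [IsProbabilityMeasure μ] :
    fourierMeasure μ 0 = 1 := by
  simp [fourierMeasure, expFun]

lemma norm_fourierMeasure_neg {d : ℕ} (μ : Measure (Fin d → ℝ)) (ξ : Fin d → ℝ) :
    ‖fourierMeasure μ (-ξ)‖ = ‖fourierMeasure μ ξ‖ := by
  rw [fourierMeasure_neg, RCLike.norm_conj]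

lemma norm_expLp {d : ℕ} (μ : Measure (Fin d → ℝ)) [IsProbabilityMeasure μ] (ξ : Fin d → ℝ) :
    ‖expLp μ ξ‖ = 1 := by
  have h := inner_self_eq_norm_sq_to_K (𝕜 := ℂ) (expLp μ ξ)
  rw [inner_expLp_expLp, sub_self, fourierMeasure_zero] at h
  have h2 : ‖expLp μ ξ‖ ^ 2 = 1 := by
    apply Complex.ofReal_injective
    push_cast
    exact h.symm
  exact (pow_eq_one_iff_of_nonneg (norm_nonneg _) two_ne_zero).1 h2

/-- The criterion of Jorgensen and Pedersen: orthogonality together with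
`∑_{l ∈ S} |μ̂(ξ + l)|² = 1` for all `ξ` makes `S` a spectrum. -/
lemma isSpectrum_of_tsum_eq_one {d : ℕ} (μ : ProbabilityMeasure (Fin d → ℝ))
    {S : Set (Fin d → ℝ)} (hS : S.Countable)
    (horth : ∀ l ∈ S, ∀ l' ∈ S, l ≠ l' → fourierMeasure (μ : Measure (Fin d → ℝ)) (l - l') = 0)
    (hsum : ∀ ξ, ∑' l : S, ‖fourierMeasure (μ : Measure (Fin d → ℝ)) (ξ + l)‖ ^ 2 = 1) :
    IsSpectrum μ S := by
  have hv : Orthonormal ℂ fun l : S => expLp (μ : Measure (Fin d → ℝ)) l.1 := by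
    refine ⟨fun l => norm_expLp _ _, fun l l' hne => ?_⟩
    change inner ℂ (expLp _ _) (expLp _ _) = 0
    rw [inner_expLp_expLp]
    exact horth _ l'.2 _ l.2 fun h => hne (Subtype.ext h.symm)
  have hbot : (Submodule.span ℂ
      (Set.range fun l : S => expLp (μ : Measure (Fin d → ℝ)) l.1))ᗮ = ⊥ := by
    rw [Submodule.eq_bot_iff]
    intro f hf
    have hf' : ∀ l : S, inner ℂ (expLp (μ : Measure (Fin d → ℝ)) l.1) f = 0 := fun l =>
      (Submodule.mem_orthogonal _ _).1 hf _ (Submodule.subset_span ⟨l, rfl⟩)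
    have h1 : ∀ ξ, inner ℂ f (expLp (μ : Measure (Fin d → ℝ)) ξ) = 0 := by
      intro ξ
      refine hv.inner_eq_zero_of_tsum_eq ?_ hf'
      rw [norm_expLp, one_pow, ← hsum (-ξ)]
      refine tsum_congr fun l => ?_
      rw [inner_expLp_expLp, ← norm_fourierMeasure_neg, neg_sub, neg_add_eq_sub]
    have h2 : (f : (Fin d → ℝ) → ℂ) =ᵐ[(μ : Measure (Fin d → ℝ))] 0 := by
      refine ae_eq_zero_of_forall_integral_expFun
        ((Lp.memLp f).integrable (by norm_num)) fun ξ => ?_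
      have := inner_eq_zero_symm.1 (h1 (-ξ))
      rwa [inner_expLp, neg_neg] at this
    exact (Lp.eq_zero_iff_ae_eq_zero).2 h2
  refine ⟨hS, HilbertBasis.mkOfOrthogonalEqBot hv hbot, fun l => ?_⟩
  rw [HilbertBasis.coe_mkOfOrthogonalEqBot]
  exact coeFn_expLp _ _

/-- An infinite convolution of nearly power lattices is spectral with a spectrum in `ℤ^d`. -/
lemma IsInfiniteConvolution.isSpectrum {d : ℕ} {m : ℕ → ℕ}
    {R : ℕ → Matrix (Fin d) (Fin d) ℝ} {B : ℕ → Finset (Fin d → ℝ)}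
    {z : ∀ k, (Fin d → Fin (m k)) → (Fin d → ℤ)} (hR : ∀ k, IsDilation (m k) (R k))
    (hB : ∀ k, B k = Finset.univ.image (digitPoint R z k))
    (hz : Summable fun k => perturbedRatio (z k))
    {μ : ProbabilityMeasure (Fin d → ℝ)} (hμ : IsInfiniteConvolution R B μ) :
    IsSpectrum μ (spectrumSet m R) :=
  have hF := tendsto_prodMask hR hB hμ
  isSpectrum_of_tsum_eq_one μ spectrumSet_countable
    (fun _ hl _ hl' hne => limit_sub_eq_zero hR hF hl hl' hne)
    fun ξ => tsum_limit_eq_one hR hz hF ξ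

/-! ### Existence of the infinite convolution -/

/-- The uniform probability measure on the digits `{0, …, m - 1}^d`. -/
def digitMeasure (d m : ℕ) : Measure (Fin d → Fin m) :=
  ((m : ENNReal) ^ d)⁻¹ • ∑ u, Measure.dirac u

lemma isProbabilityMeasure_digitMeasure (d : ℕ) {m : ℕ} (hm : m ≠ 0) :
    IsProbabilityMeasure (digitMeasure d m) := by
  constructor
  have h0 : ((m : ENNReal) ^ d) ≠ 0 := pow_ne_zero _ (by exact_mod_cast hm)
  have h1 : ((m : ENNReal) ^ d) ≠ ⊤ := ENNReal.pow_ne_top (ENNReal.natCast_ne_top _)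
  simp [digitMeasure, ENNReal.inv_mul_cancel h0 h1]

lemma digitMeasure_apply (d m : ℕ) (p : (Fin d → Fin m) → Prop) [DecidablePred p] :
    digitMeasure d m {u | p u} =
      ((m : ENNReal) ^ d)⁻¹ * ((Finset.univ.filter p).card : ENNReal) := by
  rw [digitMeasure, Measure.smul_apply, Measure.finsetSum_apply, smul_eq_mul]
  congr 1
  simp [Set.indicator_apply]

section Existence

variable {d : ℕ} {m : ℕ → ℕ} {R : ℕ → Matrix (Fin d) (Fin d) ℝ}
  {B : ℕ → Finset (Fin d → ℝ)} {z : ∀ k, (Fin d → Fin (m k)) → (Fin d → ℤ)}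

/-- The law of a sequence of independent uniform digits. -/
def digitLaw (d : ℕ) (m : ℕ → ℕ) : Measure (∀ k, Fin d → Fin (m k)) :=
  Measure.infinitePi fun k => digitMeasure d (m k)

/-- The random sum of the first `n` scaled digits. -/
def partialSum (R : ℕ → Matrix (Fin d) (Fin d) ℝ)
    (z : ∀ k, (Fin d → Fin (m k)) → (Fin d → ℤ)) (n : ℕ) (ω : ∀ k, Fin d → Fin (m k)) :
    Fin d → ℝ :=
  ∑ k ∈ Finset.range n, scaledPoint R z k (ω k)

/-- The random sum of all scaled digits (with the value `0` of `tsum` on the null set on which the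
series diverges). -/
def limitSum (R : ℕ → Matrix (Fin d) (Fin d) ℝ)
    (z : ∀ k, (Fin d → Fin (m k)) → (Fin d → ℤ)) (ω : ∀ k, Fin d → Fin (m k)) : Fin d → ℝ :=
  ∑' k, scaledPoint R z k (ω k)

lemma isProbabilityMeasure_digitLaw (hR : ∀ k, IsDilation (m k) (R k)) :
    IsProbabilityMeasure (digitLaw d m) := by
  have := fun k => isProbabilityMeasure_digitMeasure d (hR k).ne_zero
  unfold digitLaw
  infer_instance

lemma digitLaw_eval (hR : ∀ k, IsDilation (m k) (R k)) (k : ℕ) (p : (Fin d → Fin (m k)) → Prop)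
    [DecidablePred p] : digitLaw d m {ω | p (ω k)} =
      ((m k : ENNReal) ^ d)⁻¹ * ((Finset.univ.filter p).card : ENNReal) := by
  have := fun k => isProbabilityMeasure_digitMeasure d (hR k).ne_zero
  rw [← digitMeasure_apply]
  exact (measurePreserving_eval_infinitePi (fun k => digitMeasure d (m k)) k).measure_preimage
    (Set.Finite.measurableSet (Set.toFinite _)).nullMeasurableSet

lemma measurable_scaledPoint_eval (k : ℕ) :
    Measurable fun ω : ∀ k, Fin d → Fin (m k) => scaledPoint R z k (ω k) :=
  (Measurable.of_discrete (f := scaledPoint R z k)).comp (measurable_pi_apply k)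

lemma measurable_partialSum (n : ℕ) : Measurable (partialSum R z n) :=
  Finset.measurable_sum _ fun k _ => measurable_scaledPoint_eval k

lemma map_scaledPoint_eval (hR : ∀ k, IsDilation (m k) (R k))
    (hB : ∀ k, B k = Finset.univ.image (digitPoint R z k)) (k : ℕ) :
    (digitLaw d m).map (fun ω => scaledPoint R z k (ω k)) = uniformDirac (scaledDigits R B k) := by
  have := fun k => isProbabilityMeasure_digitMeasure d (hR k).ne_zero
  have h : (digitLaw d m).map (fun ω => ω k) = digitMeasure d (m k) :=
    Measure.infinitePi_map_eval (fun k => digitMeasure d (m k)) k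
  have hf : Measurable (scaledPoint R z k) := Measurable.of_discrete
  rw [← Function.comp_def (scaledPoint R z k) fun ω : ∀ k, Fin d → Fin (m k) => ω k,
    ← Measure.map_map hf (measurable_pi_apply k), h, uniformDirac_scaledDigits hR hB, digitMeasure,
    Measure.map_smul, Measure.map_finset_sum hf.aemeasurable]
  simp_rw [Measure.map_dirac' hf]

lemma map_partialSum (hR : ∀ k, IsDilation (m k) (R k))
    (hB : ∀ k, B k = Finset.univ.image (digitPoint R z k)) (n : ℕ) :
    (digitLaw d m).map (partialSum R z n) = finiteConvolution R B n := by
  have := fun k => isProbabilityMeasure_digitMeasure d (hR k).ne_zero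
  have := isProbabilityMeasure_digitLaw hR
  induction n with
  | zero =>
    have : partialSum R z 0 = fun _ => 0 := by funext ω; simp [partialSum]
    rw [this, Measure.map_const, measure_univ, one_smul, finiteConvolution]
  | succ n ih =>
    have hindep : ProbabilityTheory.IndepFun (partialSum R z n)
        (fun ω => scaledPoint R z n (ω n)) (digitLaw d m) := by
      have h := (ProbabilityTheory.iIndepFun_infinitePi (P := fun k => digitMeasure d (m k))
        (X := scaledPoint R z) fun k => Measurable.of_discrete).indepFun_finsetSum_of_notMem
          (fun k => measurable_scaledPoint_eval k) (s := Finset.range n) (i := n) (by simp)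
      have hsum : partialSum R z n = ∑ k ∈ Finset.range n,
          fun ω : ∀ k, Fin d → Fin (m k) => scaledPoint R z k (ω k) := by
        funext ω
        simp [partialSum]
      rwa [hsum]
    have hsum : partialSum R z (n + 1) =
        partialSum R z n + fun ω => scaledPoint R z n (ω n) := by
      funext ω; simp [partialSum, Finset.sum_range_succ]
    rw [hsum, hindep.map_add_eq_map_conv_map (measurable_partialSum n)
      (measurable_scaledPoint_eval n), ih, map_scaledPoint_eval hR hB, finiteConvolution]

lemma norm_scaledPoint_le (hR : ∀ k, IsDilation (m k) (R k)) {k : ℕ} {u : Fin d → Fin (m k)}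
    (hu : z k u = 0) : ‖scaledPoint R z k u‖ ≤ d * (1 / 2) ^ k := by
  have hm : (0 : ℝ) < m k := by exact_mod_cast Nat.pos_of_ne_zero (hR k).ne_zero
  refine (pi_norm_le_iff_of_nonneg (by positivity)).2 fun i => ?_
  have h0 : intVec (0 : Fin d → ℤ) = 0 := by ext; simp [intVec]
  have h1 : scaledPoint R z k u i = dualScale R (k + 1) (Pi.single i 1) ⬝ᵥ digitVec u := by
    rw [← one_mul (scaledPoint R z k u i), ← single_dotProduct, dotProduct_scaledPoint hR, hu, h0,
      dotProduct_zero, add_zero]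
  have h2 : ‖dualScale R (k + 1) (Pi.single i 1)‖ ≤ (1 / 2) ^ k / m k := by
    refine (norm_dualScale_succ_le hR _ _).trans ?_
    have h3 := norm_dualScale_add_le hR 0 k (Pi.single i (1 : ℝ))
    rw [zero_add, dualScale_zero, Pi.norm_single, norm_one] at h3
    gcongr
    rwa [one_div_pow]
  rw [h1, dotProduct]
  refine (norm_sum_le_of_le (n := fun _ => (1 / 2 : ℝ) ^ k) _ fun j _ => ?_).trans ?_
  · rw [norm_mul]
    have h4 : ‖(digitVec u j : ℝ)‖ ≤ m k := by
      rw [digitVec, Real.norm_natCast]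
      exact_mod_cast (u j).2.le
    calc _ ≤ (1 / 2 : ℝ) ^ k / m k * m k :=
          mul_le_mul ((norm_le_pi_norm _ j).trans h2) h4 (norm_nonneg _) (by positivity)
      _ = _ := div_mul_cancel₀ _ hm.ne'
  · simp

/-- By the Borel–Cantelli lemma almost surely only finitely many digits are perturbed, and the
series of unperturbed digits converges geometrically. -/
lemma ae_summable_scaledPoint (hR : ∀ k, IsDilation (m k) (R k))
    (hz : Summable fun k => perturbedRatio (z k)) :
    ∀ᵐ ω ∂(digitLaw d m), Summable fun k => scaledPoint R z k (ω k) := by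
  have hfin : ∑' k, digitLaw d m {ω | z k (ω k) ≠ 0} ≠ ⊤ := by
    have h : ∀ k, digitLaw d m {ω | z k (ω k) ≠ 0} = ENNReal.ofReal (perturbedRatio (z k)) := by
      intro k
      have hm : (0 : ℝ) < (m k : ℝ) ^ d := by
        have := Nat.pos_of_ne_zero (hR k).ne_zero
        positivity
      rw [digitLaw_eval hR k fun u => z k u ≠ 0, perturbedRatio, ENNReal.ofReal_div_of_pos hm,
        ENNReal.ofReal_natCast, ENNReal.ofReal_pow (Nat.cast_nonneg _), ENNReal.ofReal_natCast,
        ENNReal.div_eq_inv_mul]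
    simp_rw [h]
    exact hz.tsum_ofReal_ne_top
  have h0 := measure_setOfPred_frequently_eq_zero hfin
  have hae : ∀ᵐ ω ∂(digitLaw d m), ¬ ∃ᶠ k in atTop, z k (ω k) ≠ 0 := by
    rw [ae_iff]; simpa only [not_not] using h0
  filter_upwards [hae] with ω hω
  rw [not_frequently] at hω
  refine Summable.of_norm_bounded_eventually_nat (g := fun k => d * (1 / 2 : ℝ) ^ k)
    (summable_geometric_two.mul_left _) ?_
  filter_upwards [hω] with k hk
  exact norm_scaledPoint_le hR (not_not.1 hk)

lemma ae_tendsto_partialSum (hR : ∀ k, IsDilation (m k) (R k))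
    (hz : Summable fun k => perturbedRatio (z k)) :
    ∀ᵐ ω ∂(digitLaw d m), Tendsto (fun n => partialSum R z n ω) atTop (𝓝 (limitSum R z ω)) := by
  filter_upwards [ae_summable_scaledPoint hR hz] with ω hω
  exact hω.hasSum.tendsto_sum_nat

lemma aemeasurable_limitSum (hR : ∀ k, IsDilation (m k) (R k))
    (hz : Summable fun k => perturbedRatio (z k)) : AEMeasurable (limitSum R z) (digitLaw d m) :=
  aemeasurable_of_tendsto_metrizable_ae atTop (fun n => (measurable_partialSum n).aemeasurable)
    (ae_tendsto_partialSum hR hz)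

/-- The infinite convolution exists and is the law of the sum of the random series. -/
lemma exists_isInfiniteConvolution (hR : ∀ k, IsDilation (m k) (R k))
    (hB : ∀ k, B k = Finset.univ.image (digitPoint R z k))
    (hz : Summable fun k => perturbedRatio (z k)) :
    ∃ μ : ProbabilityMeasure (Fin d → ℝ), IsInfiniteConvolution R B μ ∧
      (μ : Measure (Fin d → ℝ)) = (digitLaw d m).map (limitSum R z) := by
  have := isProbabilityMeasure_digitLaw (d := d) hR
  have hS := aemeasurable_limitSum hR hz
  refine ⟨⟨(digitLaw d m).map (limitSum R z), Measure.isProbabilityMeasure_map hS⟩,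
    fun f => ?_, rfl⟩
  simp_rw [← map_partialSum hR hB]
  rw [ProbabilityMeasure.coe_mk, integral_map hS f.continuous.aestronglyMeasurable]
  have h : ∀ n, ∫ x, f x ∂(digitLaw d m).map (partialSum R z n) =
      ∫ ω, f (partialSum R z n ω) ∂(digitLaw d m) := fun n =>
    integral_map (measurable_partialSum n).aemeasurable f.continuous.aestronglyMeasurable
  simp_rw [h]
  refine tendsto_integral_of_dominated_convergence (fun _ => ‖f‖)
    (fun n => (f.continuous.measurable.comp (measurable_partialSum n)).aestronglyMeasurable)
    (integrable_const _) (fun n => ae_of_all _ fun ω => f.norm_coe_le_norm _) ?_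
  filter_upwards [ae_tendsto_partialSum hR hz] with ω hω
  exact (f.continuous.tendsto _).comp hω

end Existence

/-! ### A convolution whose support is not compact -/

/-- The moduli `2, 4, 8, …`. -/
def dyadicModulus (k : ℕ) : ℕ := 2 ^ (k + 1)

/-- The homothety by `2 ^ (k + 1)`. -/
def dyadicMatrix (d : ℕ) (k : ℕ) : Matrix (Fin d) (Fin d) ℝ :=
  (dyadicModulus k : ℝ) • (1 : Matrix (Fin d) (Fin d) ℝ)

/-- The translation vector that only moves the digit `0`. It is so large that, after the scaling
by `R_0⁻¹ ⋯ R_k⁻¹`, the digit `0` is sent to the vector with all coordinates equal to `k`. -/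
def escapingShift (d : ℕ) (k : ℕ) (x : Fin d → ℝ) : Fin d → ℤ :=
  if x = 0 then fun _ => k * ∏ j ∈ Finset.range k, (dyadicModulus j : ℤ) else 0

/-- `escapingShift` as a function of the digit. -/
def escapingDigits (d : ℕ) (k : ℕ) (u : Fin d → Fin (dyadicModulus k)) : Fin d → ℤ :=
  escapingShift d k (digitVec u)

/-- The digit sets `{0, …, 2 ^ (k + 1) - 1}^d` with the digit `0` moved far away. -/
def escapingSet (d : ℕ) (k : ℕ) : Finset (Fin d → ℝ) :=
  Finset.univ.image (digitPoint (dyadicMatrix d) (escapingDigits d) k)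

lemma dyadicModulus_pos (k : ℕ) : (0 : ℝ) < dyadicModulus k := by
  simp [dyadicModulus]

lemma isDilation_dyadicMatrix (d k : ℕ) : IsDilation (dyadicModulus k) (dyadicMatrix d k) where
  two_le := by rw [dyadicModulus, pow_succ]; have := Nat.one_le_two_pow (n := k); omega
  isUnit := by
    rw [Matrix.isUnit_iff_isUnit_det, dyadicMatrix, Matrix.det_smul, Matrix.det_one, mul_one]
    exact (pow_ne_zero _ (dyadicModulus_pos k).ne').isUnit
  multiple i j := ⟨if i = j then 1 else 0, by
    rw [dyadicMatrix, Matrix.smul_apply, Matrix.one_apply]; split_ifs <;> simp⟩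
  cube_subset := by
    intro x hx
    have hm := dyadicModulus_pos k
    refine ⟨(dyadicModulus k : ℝ)⁻¹ • x, fun i => ?_, ?_⟩
    · have h := abs_le.2 (hx i)
      rw [Set.mem_Icc, ← abs_le, Pi.smul_apply, smul_eq_mul, abs_mul, abs_of_pos (inv_pos.2 hm),
        inv_mul_le_iff₀ hm, mul_one]
      exact h
    · simp [dyadicMatrix, Matrix.smul_mulVec, smul_smul, mul_inv_cancel₀ hm.ne']

lemma prodInv_dyadicMatrix (d n : ℕ) : prodInv (dyadicMatrix d) n =
    (∏ j ∈ Finset.range n, (dyadicModulus j : ℝ))⁻¹ • (1 : Matrix (Fin d) (Fin d) ℝ) := by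
  induction n with
  | zero => simp [prodInv_zero]
  | succ n ih =>
    have h : (dyadicMatrix d n)⁻¹ = (dyadicModulus n : ℝ)⁻¹ • (1 : Matrix (Fin d) (Fin d) ℝ) := by
      refine Matrix.inv_eq_right_inv ?_
      rw [dyadicMatrix, smul_mul_smul_comm, mul_inv_cancel₀ (dyadicModulus_pos n).ne', one_mul,
        one_smul]
    rw [prodInv_succ, ih, h, smul_mul_smul_comm, Finset.prod_range_succ, mul_inv, one_mul]

lemma scaledPoint_dyadic (d k : ℕ) (u : Fin d → Fin (dyadicModulus k)) (i : Fin d) :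
    scaledPoint (dyadicMatrix d) (escapingDigits d) k u i =
      (∏ j ∈ Finset.range (k + 1), (dyadicModulus j : ℝ))⁻¹ *
        (((u i : ℕ) : ℝ) + dyadicModulus k * (escapingDigits d k u i : ℝ)) := by
  have h : invProd (dyadicMatrix d) k = prodInv (dyadicMatrix d) (k + 1) := rfl
  rw [scaledPoint, h, prodInv_dyadicMatrix, Matrix.smul_mulVec, Matrix.one_mulVec, digitPoint,
    dyadicMatrix, Matrix.smul_mulVec, Matrix.one_mulVec]
  rfl

lemma scaledPoint_dyadic_nonneg (d k : ℕ) (u : Fin d → Fin (dyadicModulus k)) (i : Fin d) :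
    0 ≤ scaledPoint (dyadicMatrix d) (escapingDigits d) k u i := by
  rw [scaledPoint_dyadic]
  have h : (0 : ℝ) ≤ (escapingDigits d k u i : ℝ) := by
    rw [escapingDigits, escapingShift]
    split_ifs
    · push_cast; positivity
    · simp
  positivity

lemma scaledPoint_dyadic_zero (d k : ℕ) {u : Fin d → Fin (dyadicModulus k)} (hu : digitVec u = 0)
    (i : Fin d) : scaledPoint (dyadicMatrix d) (escapingDigits d) k u i = k := by
  have h0 : ((u i : ℕ) : ℝ) = 0 := congrFun hu i
  have hp : ∏ j ∈ Finset.range k, (dyadicModulus j : ℝ) ≠ 0 :=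
    Finset.prod_ne_zero_iff.2 fun j _ => (dyadicModulus_pos j).ne'
  have hm := (dyadicModulus_pos k).ne'
  rw [scaledPoint_dyadic, h0, escapingDigits, escapingShift, if_pos hu, Finset.prod_range_succ]
  push_cast
  field_simp
  ring

lemma digitVec_injective (d m : ℕ) :
    Function.Injective (digitVec : (Fin d → Fin m) → Fin d → ℝ) := by
  intro u v h
  ext i
  have h1 : ((u i : ℕ) : ℝ) = ((v i : ℕ) : ℝ) := congrFun h i
  exact_mod_cast h1

lemma summable_perturbedRatio_escapingDigits {d : ℕ} (hd : 1 ≤ d) :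
    Summable fun k => perturbedRatio (escapingDigits d k) := by
  refine Summable.of_nonneg_of_le (fun k => perturbedRatio_nonneg _) (fun k => ?_)
    summable_geometric_two
  have hcard : (Finset.univ.filter fun u => escapingDigits d k u ≠ 0).card ≤ 1 := by
    refine Finset.card_le_one.2 fun u hu v hv => digitVec_injective _ _ ?_
    have h : ∀ w : Fin d → Fin (dyadicModulus k), escapingDigits d k w ≠ 0 → digitVec w = 0 := by
      intro w hw
      by_contra h0
      exact hw (if_neg h0)
    rw [h u (Finset.mem_filter.1 hu).2, h v (Finset.mem_filter.1 hv).2]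
  have hm : (2 : ℝ) ^ k ≤ (dyadicModulus k : ℝ) ^ d := by
    have h1 : (2 : ℝ) ^ k ≤ dyadicModulus k := by
      rw [dyadicModulus]; push_cast
      exact pow_le_pow_right₀ one_le_two (Nat.le_succ k)
    have h2 : (1 : ℝ) ≤ dyadicModulus k := (one_le_pow₀ one_le_two).trans h1
    exact h1.trans (le_self_pow₀ h2 (by omega))
  calc perturbedRatio (escapingDigits d k) ≤ 1 / (dyadicModulus k : ℝ) ^ d := by
        unfold perturbedRatio
        gcongr
        exact_mod_cast hcard
    _ ≤ 1 / 2 ^ k := by gcongr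
    _ = (1 / 2) ^ k := (one_div_pow _ _).symm

lemma nearlyPowerLattices_escapingSet {d : ℕ} (hd : 1 ≤ d) :
    NearlyPowerLattices dyadicModulus (dyadicMatrix d) (escapingSet d) := by
  refine ⟨fun k => ⟨escapingShift d k, ?_⟩, ?_⟩
  · rw [powerLattice_eq, Finset.image_image]; rfl
  · simp_rw [card_sdiff_powerLattice (isDilation_dyadicMatrix d) (fun _ => rfl :
      ∀ k, escapingSet d k = Finset.univ.image (digitPoint (dyadicMatrix d) (escapingDigits d) k))]
    exact summable_perturbedRatio_escapingDigits hd

/-- All coordinates of the random sum are nonnegative, and they are at least `k` with positive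
probability, for every `k`. -/
lemma not_isCompact_support_map_limitSum {d : ℕ} (hd : 1 ≤ d) :
    ¬ IsCompact ((digitLaw d dyadicModulus).map
      (limitSum (dyadicMatrix d) (escapingDigits d))).support := by
  intro hK
  have hR := isDilation_dyadicMatrix d
  have hz := summable_perturbedRatio_escapingDigits hd
  obtain ⟨C, hC⟩ := hK.isBounded.exists_norm_le
  obtain ⟨k, hk⟩ := exists_nat_gt C
  have hm : 0 < dyadicModulus k := Nat.pos_of_ne_zero (hR k).ne_zero
  have hae : ∀ᵐ ω ∂(digitLaw d dyadicModulus),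
      limitSum (dyadicMatrix d) (escapingDigits d) ω ∈ ((digitLaw d dyadicModulus).map
        (limitSum (dyadicMatrix d) (escapingDigits d))).support :=
    ae_of_ae_map (aemeasurable_limitSum hR hz) Measure.support_mem_ae
  have hpos : digitLaw d dyadicModulus {ω | digitVec (ω k) = 0} ≠ 0 := by
    rw [digitLaw_eval hR k fun u => digitVec u = 0]
    refine mul_ne_zero (ENNReal.inv_ne_zero.2 (ENNReal.pow_ne_top (ENNReal.natCast_ne_top _))) ?_
    rw [Nat.cast_ne_zero, Finset.card_ne_zero]
    refine ⟨fun _ => ⟨0, hm⟩, Finset.mem_filter.2 ⟨Finset.mem_univ _, ?_⟩⟩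
    ext i; simp [digitVec]
  have hfreq : ∃ᵐ ω ∂(digitLaw d dyadicModulus), digitVec (ω k) = 0 := frequently_ae_iff.2 hpos
  obtain ⟨ω, h0, hmem, hsum⟩ :=
    (hfreq.and_eventually (hae.and (ae_summable_scaledPoint hR hz))).exists
  set i : Fin d := ⟨0, hd⟩
  have h1 : (k : ℝ) ≤ limitSum (dyadicMatrix d) (escapingDigits d) ω i := by
    rw [← scaledPoint_dyadic_zero d k h0 i]
    exact le_hasSum (Pi.hasSum.1 hsum.hasSum i) k fun j _ => scaledPoint_dyadic_nonneg d j _ i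
  have h2 := (le_abs_self _).trans ((norm_le_pi_norm _ i).trans (hC _ hmem))
  linarith

end

theorem theorem1p1 (d : ℕ) (hd : 1 ≤ d) :
    (∀ (m : ℕ → ℕ) (R : ℕ → Matrix (Fin d) (Fin d) ℝ) (B : ℕ → Finset (Fin d → ℝ)),
      (∀ k, IsDilation (m k) (R k)) → NearlyPowerLattices m R B →
        ∃ μ : ProbabilityMeasure (Fin d → ℝ), IsInfiniteConvolution R B μ ∧
          ∃ S : Set (Fin d → ℝ), S ⊆ integerLattice d ∧ IsSpectrum μ S) ∧
    (∃ (m : ℕ → ℕ) (R : ℕ → Matrix (Fin d) (Fin d) ℝ) (B : ℕ → Finset (Fin d → ℝ))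
      (μ : ProbabilityMeasure (Fin d → ℝ)),
      (∀ k, IsDilation (m k) (R k)) ∧ NearlyPowerLattices m R B ∧
        IsInfiniteConvolution R B μ ∧ ¬ IsCompact (μ : Measure (Fin d → ℝ)).support) := by
  constructor
  · intro m R B hR hB
    obtain ⟨z, hz⟩ := exists_digits hB.1
    have hsum : Summable fun k => perturbedRatio (z k) := by
      simp_rw [← card_sdiff_powerLattice hR hz]
      exact hB.2
    obtain ⟨μ, hμ, -⟩ := exists_isInfiniteConvolution hR hz hsum
    exact ⟨μ, hμ, spectrumSet m R, spectrumSet_subset hR, hμ.isSpectrum hR hz hsum⟩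
  · obtain ⟨μ, hμ, hlaw⟩ := exists_isInfiniteConvolution (isDilation_dyadicMatrix d)
      (fun _ => rfl : ∀ k, escapingSet d k =
        Finset.univ.image (digitPoint (dyadicMatrix d) (escapingDigits d) k))
      (summable_perturbedRatio_escapingDigits hd)
    refine ⟨dyadicModulus, dyadicMatrix d, escapingSet d, μ, isDilation_dyadicMatrix d,
      nearlyPowerLattices_escapingSet hd, hμ, ?_⟩
    rw [hlaw]
    exact not_isCompact_support_map_limitSum hd
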